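/- Let $n\ge 1$ and let $\gamma$ be the standard Gaussian measure on $\mathbb R^n$ with the Euclidean norm. For probability measures $\mu,\nu$ on $\mathbb R^n$ let $$W_2(\mu,\nu)=\inf_\pi\Big(\int \tfrac12|x-y|^2\,d\pi(x,y)\Big)^{1/2},$$ the infimum being taken over all couplings $\pi$ of $\mu$ and $\nu$ (note the factor $\tfrac12$ in the cost). A probability density with respect to $\gamma$ is a measurable $h\ge 0$ with $\int h\,d\gamma=1$; for such $h$ let $\mathrm{Ent}_\gamma(h)=\int h\log h\,d\gamma\in[0,+\infty]$. (1) (Refined Talagrand inequality.) For every probability density $h$ with respect to $\gamma$ that is of class $C^2$ and satisfies $\Delta h\in L^1(\gamma)$, $$W_2^2(h\gamma,\gamma)\le \frac12\int\Delta h\,d\gamma+n\Big(1-\exp\Big(\frac1{2n}\int\Delta h\,d\gamma-\frac1n\mathrm{Ent}_\gamma(h)\Big)\Big),$$ where the exponential is $0$ if $\mathrm{Ent}_\gamma(h)=+\infty$. (2) Inequality (1) implies the classical Talagrand inequality: for every probability density $h$ with respect to $\gamma$, $$W_2^2(h\gamma,\gamma)\le \mathrm{Ent}_\gamma(h).$$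 (3) Inequality (1) implies the refined Poincaré inequality: for every $f\in C^2(\mathbb R^n)$ with $\Delta f\in L^1(\gamma)$, $$\mathrm{Var}_\gamma(f)\le\int|\nabla f|^2\,d\gamma-\frac1{2n}\Big(\int\Delta f\,d\gamma\Big)^2,$$ where both sides may be $+\infty$, and $\mathrm{Var}_\gamma(f)<\infty$ whenever $\int|\nabla f|^2\,d\gamma<\infty$. -/

import Mathlib

open MeasureTheory ProbabilityTheory
open scoped ENNReal

noncomputable section

namespace GaussTransport

/-- `π` is a coupling of `μ` and `ν`: its marginals are `μ` and `ν`. -/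
def IsCoupling {E : Type*} [MeasurableSpace E] (π : Measure (E × E)) (μ ν : Measure E) : Prop :=
  π.fst = μ ∧ π.snd = ν

/-- The quadratic Wasserstein distance with the normalisation of the cost by `1/2`:
`W₂(μ, ν) = inf_π (∫ d(x, y)² / 2 dπ(x, y))^{1/2}` over all couplings `π`. -/
def W2 {E : Type*} [PseudoEMetricSpace E] [MeasurableSpace E] (μ ν : Measure E) : ℝ≥0∞ :=
  ⨅ (π : Measure (E × E)) (_ : IsCoupling π μ ν),
    (∫⁻ p, edist p.1 p.2 ^ 2 / 2 ∂π) ^ (1 / 2 : ℝ)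

open Classical in
/-- `Ent_μ(h) = ∫ h log h dμ - (∫ h dμ) log (∫ h dμ)`. For a nonnegative `μ`-integrable `h` and a
finite measure `μ` the negative part of `h log h` is bounded, so that `∫ h log h dμ = +∞` when
`h log h` is not integrable. -/
def Ent {E : Type*} [MeasurableSpace E] (μ : Measure E) (h : E → ℝ) : EReal :=
  if Integrable (fun x => h x * Real.log (h x)) μ then
    ((∫ x, h x * Real.log (h x) ∂μ - (∫ x, h x ∂μ) * Real.log (∫ x, h x ∂μ) : ℝ) : EReal)
  else ⊤

/-- `h` is a probability density with respect to `μ` (a function with `∫ h dμ = 1` is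
automatically integrable). -/
def IsProbDensity {E : Type*} [MeasurableSpace E] (μ : Measure E) (h : E → ℝ) : Prop :=
  Measurable h ∧ (∀ x, 0 ≤ h x) ∧ ∫ x, h x ∂μ = 1

/-- The measure `hμ`. -/
def densMeasure {E : Type*} [MeasurableSpace E] (μ : Measure E) (h : E → ℝ) : Measure E :=
  μ.withDensity fun x => ENNReal.ofReal (h x)

/-- The standard Gaussian measure on `ℝⁿ`. -/
abbrev gauss (n : ℕ) : Measure (EuclideanSpace ℝ (Fin n)) :=
  stdGaussian (EuclideanSpace ℝ (Fin n))

/-- The refined Talagrand inequality for the standard Gaussian measure, for all `C²` probability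
densities with an integrable Laplacian. If the entropy is infinite then the exponential is `0`. -/
def RefinedTalagrand (n : ℕ) : Prop :=
  ∀ h : EuclideanSpace ℝ (Fin n) → ℝ,
    IsProbDensity (gauss n) h → ContDiff ℝ 2 h → Integrable (Laplacian.laplacian h) (gauss n) →
    ((W2 (densMeasure (gauss n) h) (gauss n) ^ 2 : ℝ≥0∞) : EReal) ≤
      ((1 / 2 * ∫ x, Laplacian.laplacian h x ∂(gauss n) : ℝ) : EReal) +
        (n : EReal) * (1 - (EReal.exp
          (((1 / (2 * n) * ∫ x, Laplacian.laplacian h x ∂(gauss n) : ℝ) : EReal) -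
            ((1 / n : ℝ) : EReal) * Ent (gauss n) h) : EReal))

/-- The classical Talagrand inequality, for all probability densities. -/
def ClassicalTalagrand (n : ℕ) : Prop :=
  ∀ h : EuclideanSpace ℝ (Fin n) → ℝ, IsProbDensity (gauss n) h →
    ((W2 (densMeasure (gauss n) h) (gauss n) ^ 2 : ℝ≥0∞) : EReal) ≤ Ent (gauss n) h

/-- The refined Poincaré inequality, for all `C²` functions with an integrable Laplacian. Variance
and Dirichlet integral take values in `[0, ∞]`; in particular the variance is finite as soon as
the Dirichlet integral is. -/
def RefinedPoincare (n : ℕ) : Prop :=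
  ∀ f : EuclideanSpace ℝ (Fin n) → ℝ,
    ContDiff ℝ 2 f → Integrable (Laplacian.laplacian f) (gauss n) →
    (evariance f (gauss n) : EReal) ≤
      ((∫⁻ x, ‖gradient f x‖ₑ ^ 2 ∂(gauss n) : ℝ≥0∞) : EReal) -
        ((1 / (2 * n) * (∫ x, Laplacian.laplacian f x ∂(gauss n)) ^ 2 : ℝ) : EReal)

end GaussTransport

end

noncomputable section

namespace GaussTransport

open Set Filter Topology

/-! Let M be the integral of h|x|² against γ and let E be the entropy of h. The transport
inequalities rest on a family of bounds indexed by c > 0: some map T carrying hγ to γ satisfies ∫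
x·T d(hγ) ≥ c (n(1/2 - log c) + M/2 - E). As ∫ |T|² d(hγ) = n, expanding |x - T|² bounds W₂² by M/2
+ n/2 minus that right-hand side (`W2_sq_le_entropy`).

On the line, T is the monotone rearrangement of μ = kγ. Since T has mean zero, Fubini turns ∫ xT dμ
into the integral over s of the tail moments ∫_{x>s} T dμ. Such a tail equals φ(T(s)), with φ the
Gaussian density, because T pushes μ to γ and ∫_a^∞ yφ(y) dy = φ(a). The inequality log z ≤ z - 1 at
z = φ(T)/(cφk) now gives the bound, and no derivative of T is ever taken
(`le_integral_mul_toGauss`). In dimension n, T is triangular (Knothe): one coordinate is transported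
conditionally on the others, and the chain rule for the entropy makes the bounds add up with a
common c (`exists_transport`).

The choice c = 1 gives the classical inequality. For the refined one, two Gaussian integrations by
parts give ∫ Δh dγ = M - n. Radial cut-offs justify them and, h being nonnegative, also show that M
is finite. The optimal c is then exactly the exponential in the statement. If E is infinite, the
independent coupling, of cost M/2 + n/2, already suffices.

The refined Poincaré inequality is the ordinary one for f - a|x|² with a = ∫ Δf dγ / (2n). Since ∫
Δf dγ is both ∫ x·∇f dγ and the covariance of f with |x|², the energy drops by 4na² and the variance
by 2na². The ordinary inequality is proved on the line, tensorized, and freed from boundedness by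
truncation and Fatou's lemma. -/

/-! ### Monotone transport onto the standard Gaussian measure on the line -/

/-- The standard Gaussian measure on the line. -/
abbrev gaussLine : Measure ℝ := gaussianReal 0 1

instance nullSingletonClass_gaussLine : NullSingletonClass gaussLine :=
  nullSingletonClass_gaussianReal one_ne_zero

lemma continuous_cdf (μ : Measure ℝ) [IsProbabilityMeasure μ] [NullSingletonClass μ] :
    Continuous (cdf μ) := by
  rw [continuous_iff_continuousAt]
  intro x
  rw [(monotone_cdf μ).continuousAt_iff_leftLim_eq_rightLim]
  have h : (cdf μ).measure {x} = 0 := by rw [measure_cdf]; exact measure_singleton x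
  rw [StieltjesFunction.measure_singleton, ENNReal.ofReal_eq_zero] at h
  rw [StieltjesFunction.rightLim_eq]
  exact le_antisymm ((monotone_cdf μ).leftLim_le le_rfl) (by linarith)

lemma strictMono_cdf_gaussLine : StrictMono (cdf gaussLine) := by
  intro a b hab
  refine lt_of_le_of_ne (monotone_cdf _ hab.le) fun h => ?_
  have h1 : gaussLine (Ioc a b) = 0 := by
    rw [← measure_cdf gaussLine, StieltjesFunction.measure_Ioc]
    simp [h]
  have h2 := gaussianReal_absolutelyContinuous' 0 (one_ne_zero (α := NNReal)) h1
  simp at h2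
  linarith

lemma cdf_gaussLine_mem (y : ℝ) : cdf gaussLine y ∈ Ioo (0 : ℝ) 1 :=
  ⟨(cdf_nonneg _ (y - 1)).trans_lt (strictMono_cdf_gaussLine (by linarith)),
    (strictMono_cdf_gaussLine (by linarith : y < y + 1)).trans_le (cdf_le_one _ _)⟩

lemma exists_cdf_eq (μ : Measure ℝ) [IsProbabilityMeasure μ] [NullSingletonClass μ] {u : ℝ}
    (hu : u ∈ Ioo (0 : ℝ) 1) : ∃ y, cdf μ y = u :=
  mem_range_of_exists_le_of_exists_ge (continuous_cdf μ)
    (((tendsto_cdf_atBot μ).eventually_le_const hu.1).exists)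
    (((tendsto_cdf_atTop μ).eventually_const_le hu.2).exists)

open Classical in
/-- The quantile function of the standard Gaussian measure on `(0, 1)`, extended by `0`. -/
def gaussQuantile (u : ℝ) : ℝ :=
  if hu : u ∈ Ioo (0 : ℝ) 1 then (exists_cdf_eq gaussLine hu).choose else 0

lemma cdf_gaussQuantile {u : ℝ} (hu : u ∈ Ioo (0 : ℝ) 1) :
    cdf gaussLine (gaussQuantile u) = u := by
  rw [gaussQuantile, dif_pos hu]
  exact (exists_cdf_eq gaussLine hu).choose_spec

/-- This adjunction reduces both the measurability of the quantile and the law of the transport to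
sublevel sets of a cdf. -/
lemma gaussQuantile_le_iff {u y : ℝ} (hu : u ∈ Ioo (0 : ℝ) 1) :
    gaussQuantile u ≤ y ↔ u ≤ cdf gaussLine y := by
  conv_rhs => rw [← cdf_gaussQuantile hu]
  exact strictMono_cdf_gaussLine.le_iff_le.symm

lemma measurable_gaussQuantile : Measurable gaussQuantile := by
  refine measurable_of_Iic fun y => ?_
  -- Off (0, 1) the quantile takes its default value 0, so the complement belongs to the sublevel
  -- set exactly when 0 ≤ y.
  have : gaussQuantile ⁻¹' Iic y =
      (Ioo 0 1 ∩ Iic (cdf gaussLine y)) ∪ ((Ioo 0 1)ᶜ ∩ {_u : ℝ | (0 : ℝ) ≤ y}) := by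
    ext u
    by_cases hu : u ∈ Ioo (0 : ℝ) 1
    · simp only [mem_preimage, mem_Iic, gaussQuantile_le_iff hu]
      simp [hu.1, hu.2]
    · have h0 : gaussQuantile u = 0 := by rw [gaussQuantile, dif_neg hu]
      simp only [mem_preimage, mem_Iic, h0]
      simp only [mem_union, mem_inter_iff, hu, mem_compl_iff, mem_ofPred_eq, false_and,
        not_false_eq_true, true_and, false_or]
  rw [this]
  exact (measurableSet_Ioo.inter measurableSet_Iic).union
    (measurableSet_Ioo.compl.inter (MeasurableSet.const _))

section Line

variable (μ : Measure ℝ) [IsProbabilityMeasure μ] [NullSingletonClass μ]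

/-- The probability integral transform. -/
lemma measure_cdf_le {u : ℝ} (hu : u ∈ Ioo (0 : ℝ) 1) :
    μ {x | cdf μ x ≤ u} = ENNReal.ofReal u := by
  have hcl : IsClosed {x | cdf μ x ≤ u} := isClosed_le (continuous_cdf μ) continuous_const
  obtain ⟨y, hy⟩ := exists_cdf_eq μ hu
  have hne : {x | cdf μ x ≤ u}.Nonempty := ⟨y, hy.le⟩
  obtain ⟨b, hb⟩ := ((tendsto_cdf_atTop μ).eventually_const_lt hu.2).exists
  have hbdd : BddAbove {x | cdf μ x ≤ u} := ⟨b, fun x hx => by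
    by_contra hlt
    exact absurd (hb.trans_le (monotone_cdf μ (not_le.1 hlt).le)) (not_lt.2 hx)⟩
  -- The cdf may be constant at level u; the sublevel set is the closed ray ending at the rightmost
  -- point of that level.
  set s := sSup {x | cdf μ x ≤ u} with hs
  have hmem : cdf μ s ≤ u := hcl.csSup_mem hne hbdd
  have hys : y ≤ s := le_csSup hbdd hy.le
  have heq : cdf μ s = u := le_antisymm hmem (hy ▸ monotone_cdf μ hys)
  have hset : {x | cdf μ x ≤ u} = Iic s := by
    ext x
    exact ⟨fun hx => le_csSup hbdd hx, fun hx => (monotone_cdf μ hx).trans hmem⟩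
  rw [hset, ← ofReal_cdf, heq]

/-- Excludes the default value of the quantile: the cdf is uniformly distributed under μ, and u → 0
and u → 1 show that the two endpoints carry no mass. -/
lemma ae_cdf_mem : ∀ᵐ x ∂μ, cdf μ x ∈ Ioo (0 : ℝ) 1 := by
  have h0 : μ {x | cdf μ x ≤ 0} = 0 := by
    refine le_antisymm (ge_of_tendsto (x := 𝓝[>] (0 : ℝ)) (f := fun u => ENNReal.ofReal u) ?_ ?_) zero_le
    · have := (ENNReal.continuous_ofReal.tendsto 0).mono_left (nhdsWithin_le_nhds (s := Ioi 0))
      simpa using this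
    · filter_upwards [Ioo_mem_nhdsGT (zero_lt_one (α := ℝ))] with u hu
      rw [← measure_cdf_le μ hu]
      exact measure_mono fun x (hx : cdf μ x ≤ 0) => hx.trans hu.1.le
  have h1 : μ {x | cdf μ x < 1} = 1 := by
    refine le_antisymm prob_le_one
      (le_of_tendsto (x := 𝓝[<] (1 : ℝ)) (f := fun u => ENNReal.ofReal u) ?_ ?_)
    · have := (ENNReal.continuous_ofReal.tendsto 1).mono_left (nhdsWithin_le_nhds (s := Iio 1))
      simpa using this
    · filter_upwards [Ioo_mem_nhdsLT (zero_lt_one (α := ℝ))] with u hu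
      rw [← measure_cdf_le μ hu]
      exact measure_mono fun x (hx : cdf μ x ≤ u) => hx.trans_lt hu.2
  have h1' : ∀ᵐ x ∂μ, cdf μ x < 1 := by
    rw [← prob_compl_eq_zero_iff (measurableSet_lt (continuous_cdf μ).measurable
      measurable_const)] at h1
    exact h1
  have h0' : ∀ᵐ x ∂μ, ¬ cdf μ x ≤ 0 := by
    rw [ae_iff]; simpa using h0
  filter_upwards [h0', h1'] with x hx hx1 using ⟨not_le.1 hx, hx1⟩

/-- The monotone map that transports an atomless probability measure to the standard Gaussian. -/
def toGauss (μ : Measure ℝ) (x : ℝ) : ℝ := gaussQuantile (cdf μ x)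

lemma measurable_toGauss : Measurable (toGauss μ) :=
  measurable_gaussQuantile.comp (continuous_cdf μ).measurable

lemma map_toGauss : μ.map (toGauss μ) = gaussLine := by
  have : IsProbabilityMeasure (μ.map (toGauss μ)) :=
    Measure.isProbabilityMeasure_map (measurable_toGauss μ).aemeasurable
  refine Measure.ext_of_Iic _ _ fun a => ?_
  rw [Measure.map_apply (measurable_toGauss μ) measurableSet_Iic, ← ofReal_cdf gaussLine,
    ← measure_cdf_le μ (cdf_gaussLine_mem a)]
  refine measure_congr ?_
  filter_upwards [ae_cdf_mem μ] with x hx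
  exact propext (gaussQuantile_le_iff hx)

lemma measurePreserving_toGauss : MeasurePreserving (toGauss μ) μ gaussLine :=
  ⟨measurable_toGauss μ, map_toGauss μ⟩

lemma memLp_toGauss : MemLp (toGauss μ) 2 μ :=
  (memLp_id_gaussianReal' 2 (by simp)).comp_measurePreserving (measurePreserving_toGauss μ)

lemma integral_toGauss : ∫ x, toGauss μ x ∂μ = 0 := by
  have := integral_id_gaussianReal (μ := 0) (v := 1)
  rw [← this]
  change _ = ∫ x, id x ∂gaussLine
  rw [← map_toGauss μ, integral_map (measurable_toGauss μ).aemeasurable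
    measurable_id.aestronglyMeasurable]
  rfl

lemma integral_sq_gaussLine : ∫ x, x ^ 2 ∂gaussLine = 1 := by
  have := variance_fun_id_gaussianReal (μ := 0) (v := 1)
  rw [variance_eq_integral (by fun_prop)] at this
  simpa using this

lemma integral_toGauss_sq : ∫ x, toGauss μ x ^ 2 ∂μ = 1 := by
  rw [← integral_sq_gaussLine, ← map_toGauss μ, integral_map (measurable_toGauss μ).aemeasurable
    (by fun_prop)]

/-! ### Tail first moments of the Gaussian measure and of the transport map. -/

lemma hasDerivAt_gaussianPDFReal (x : ℝ) :
    HasDerivAt (gaussianPDFReal 0 1) (-(x * gaussianPDFReal 0 1 x)) x := by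
  unfold gaussianPDFReal
  have h : HasDerivAt (fun x : ℝ => -(x - 0) ^ 2 / (2 * ((1 : NNReal) : ℝ))) (-x) x := by
    have := (((hasDerivAt_id x).sub_const 0).pow 2).neg.div_const (2 * ((1 : NNReal) : ℝ))
    refine this.congr_deriv ?_
    simp
    ring
  refine (h.exp.const_mul _).congr_deriv ?_
  simp
  ring

lemma tendsto_gaussianPDFReal_atTop : Tendsto (gaussianPDFReal 0 1) atTop (𝓝 0) := by
  unfold gaussianPDFReal
  suffices h : Tendsto (fun x : ℝ => -(x - 0) ^ 2 / (2 * ((1 : NNReal) : ℝ))) atTop atBot by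
    simpa using (Real.tendsto_exp_atBot.comp h).const_mul (√(2 * Real.pi * ((1 : NNReal) : ℝ)))⁻¹
  simp only [sub_zero, NNReal.coe_one, mul_one, neg_div]
  exact tendsto_neg_atTop_atBot.comp
    ((tendsto_pow_atTop two_ne_zero).atTop_div_const two_pos)

lemma integrable_mul_gaussianPDFReal :
    Integrable (fun x => x * gaussianPDFReal 0 1 x) := by
  have h : Integrable (fun x : ℝ => x) gaussLine :=
    (memLp_id_gaussianReal' 1 (by simp)).integrable le_rfl
  rw [gaussLine, gaussianReal_of_var_ne_zero 0 one_ne_zero,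
    integrable_withDensity_iff (measurable_gaussianPDF 0 1) (by simp [gaussianPDF])] at h
  simpa [toReal_gaussianPDF] using h

/-- Gaussian tail first moment. -/
lemma setIntegral_Ioi_gaussLine (a : ℝ) :
    ∫ y in Ioi a, y ∂gaussLine = gaussianPDFReal 0 1 a := by
  have h1 : ∫ y in Ioi a, y ∂gaussLine = ∫ y in Ioi a, y * gaussianPDFReal 0 1 y := by
    rw [← integral_indicator measurableSet_Ioi, gaussLine,
      integral_gaussianReal_eq_integral_smul one_ne_zero, ← integral_indicator measurableSet_Ioi]
    congr 1
    ext y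
    by_cases hy : y ∈ Ioi a <;> simp [hy, mul_comm]
  rw [h1]
  have h2 := integral_Ioi_of_hasDerivAt_of_tendsto' (a := a)
    (fun x _ => (hasDerivAt_gaussianPDFReal x).neg)
    (by simpa using integrable_mul_gaussianPDFReal.integrableOn)
    (m := -0) tendsto_gaussianPDFReal_atTop.neg
  simpa using h2

/-- The tail integral of the transport map. -/
lemma setIntegral_Ioi_toGauss {s : ℝ} (hs : cdf μ s ∈ Ioo (0 : ℝ) 1) :
    ∫ x in Ioi s, toGauss μ x ∂μ = gaussianPDFReal 0 1 (toGauss μ s) := by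
  have hm := measurable_toGauss μ
  -- Only this inclusion is immediate, as T may be constant to the right of s. Both sets have mass 1
  -- - `cdf μ s`, so they agree almost everywhere.
  have hsub : toGauss μ ⁻¹' Ioi (toGauss μ s) ≤ᵐ[μ] Ioi s := by
    filter_upwards [ae_cdf_mem μ] with x hx hxs
    by_contra hle
    have : cdf μ x ≤ cdf μ s := monotone_cdf μ (not_lt.1 hle)
    have h2 : toGauss μ x ≤ toGauss μ s :=
      (gaussQuantile_le_iff hx).2 (this.trans (cdf_gaussQuantile hs).ge)
    exact absurd hxs (not_lt.2 h2)
  have hmeas : μ (toGauss μ ⁻¹' Ioi (toGauss μ s)) = μ (Ioi s) := by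
    rw [(measurePreserving_toGauss μ).measure_preimage measurableSet_Ioi.nullMeasurableSet,
      ← compl_Iic, ← compl_Iic, prob_compl_eq_one_sub measurableSet_Iic,
      prob_compl_eq_one_sub measurableSet_Iic, ← ofReal_cdf, ← ofReal_cdf, toGauss,
      cdf_gaussQuantile hs]
  have hae := ae_eq_of_ae_subset_of_measure_ge hsub hmeas.ge
    (hm measurableSet_Ioi).nullMeasurableSet (measure_ne_top _ _)
  rw [← setIntegral_congr_set hae, ← setIntegral_Ioi_gaussLine]
  conv_rhs => rw [← map_toGauss μ]
  rw [setIntegral_map measurableSet_Ioi (by fun_prop) hm.aemeasurable]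

/-- Covers the points where the density vanishes: there the cdf may be 0 or 1, and the tail is then
the full mean, which is zero, or an integral over a null set. -/
lemma setIntegral_Ioi_toGauss_nonneg (s : ℝ) : 0 ≤ ∫ x in Ioi s, toGauss μ x ∂μ := by
  by_cases hs : cdf μ s ∈ Ioo (0 : ℝ) 1
  · rw [setIntegral_Ioi_toGauss μ hs]
    exact gaussianPDFReal_nonneg _ _ _
  · rcases (cdf_nonneg μ s).eq_or_lt with h0 | h0
    · have : Ioi s =ᵐ[μ] univ := by
        rw [ae_eq_univ, compl_Ioi, ← ofReal_cdf, ← h0, ENNReal.ofReal_zero]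
      rw [setIntegral_congr_set this, setIntegral_univ, integral_toGauss]
    · have h1 : cdf μ s = 1 := by
        by_contra h
        exact hs ⟨h0, lt_of_le_of_ne (cdf_le_one μ s) h⟩
      have : μ (Ioi s) = 0 := by
        rw [← compl_Iic, prob_compl_eq_one_sub measurableSet_Iic, ← ofReal_cdf, h1]
        simp
      rw [setIntegral_measure_zero _ this]

/-- A signed layer-cake formula; subtracting the ray at 0 makes the integrand integrable in s. -/
lemma integral_indicator_Iio_sub (x : ℝ) :
    ∫ s, ((Iio x).indicator 1 s - (Iio (0 : ℝ)).indicator 1 s : ℝ) = x := by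
  have key : ∀ a b : ℝ, a ≤ b → ∀ s : ℝ,
      ((Iio b).indicator 1 s - (Iio a).indicator 1 s : ℝ) = (Ico a b).indicator 1 s := by
    intro a b hab s
    simp only [indicator_apply, mem_Iio, mem_Ico, Pi.one_apply]
    by_cases h1 : s < a
    · simp [h1, h1.trans_le hab]
    · by_cases h2 : s < b <;> simp [h1, h2, not_lt.1 h1]
  rcases le_total 0 x with hx | hx
  · simp_rw [key 0 x hx]
    rw [integral_indicator_one measurableSet_Ico]
    simp [hx]
  · have : ∀ s : ℝ, ((Iio x).indicator 1 s - (Iio (0 : ℝ)).indicator 1 s : ℝ) =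
        -((Ico x 0).indicator 1 s) := fun s => by rw [← key x 0 hx s]; ring
    simp_rw [this]
    rw [integral_neg, integral_indicator_one measurableSet_Ico]
    simp [hx]

lemma lintegral_enorm_indicator_Iio_sub (x : ℝ) :
    ∫⁻ s, ‖((Iio x).indicator 1 s - (Iio (0 : ℝ)).indicator 1 s : ℝ)‖ₑ = ‖x‖ₑ := by
  have key : ∀ s : ℝ, ‖((Iio x).indicator 1 s - (Iio (0 : ℝ)).indicator 1 s : ℝ)‖ₑ =
      (Ico (min x 0) (max x 0)).indicator 1 s := by
    intro s
    simp only [indicator_apply, mem_Iio, mem_Ico, Pi.one_apply, min_le_iff, lt_max_iff]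
    by_cases h1 : s < x <;> by_cases h2 : s < 0 <;>
      simp [h1, h2, le_of_not_gt]
  simp_rw [key]
  rw [lintegral_indicator_one measurableSet_Ico, Real.volume_Ico, max_sub_min_eq_abs',
    Real.enorm_eq_ofReal_abs]
  simp

/-- The correlation of an atomless measure with its Gaussian transport, as an integral of tail
moments. -/
lemma integrable_and_integral_mul_toGauss (h2 : MemLp id 2 μ) :
    Integrable (fun s => ∫ x in Ioi s, toGauss μ x ∂μ) ∧
      ∫ s, ∫ x in Ioi s, toGauss μ x ∂μ = ∫ x, x * toGauss μ x ∂μ := by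
  have hm := measurable_toGauss μ
  have hT : Integrable (toGauss μ) μ := (memLp_toGauss μ).integrable one_le_two
  have hxT : Integrable (fun x => x * toGauss μ x) μ := h2.integrable_mul (memLp_toGauss μ)
  -- Integrating K in s gives x T(x). Integrating it in x gives the tail moment, since the term of
  -- the ray at 0 is a multiple of the mean of T, which is zero.
  let K : ℝ × ℝ → ℝ := fun p =>
    toGauss μ p.1 * ((Iio p.1).indicator 1 p.2 - (Iio (0 : ℝ)).indicator 1 p.2)
  have hKm : Measurable K := by
    refine (hm.comp measurable_fst).mul (Measurable.sub ?_ ?_)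
    · have : (fun p : ℝ × ℝ => ((Iio p.1).indicator 1 p.2 : ℝ)) =
          {p : ℝ × ℝ | p.2 < p.1}.indicator 1 := by
        ext p; simp [indicator_apply]
      rw [this]
      exact measurable_one.indicator (measurableSet_lt measurable_snd measurable_fst)
    · exact (measurable_one.indicator measurableSet_Iio).comp measurable_snd
  have hK : Integrable K (μ.prod volume) := by
    refine ⟨hKm.aestronglyMeasurable, ?_⟩
    rw [hasFiniteIntegral_iff_enorm, lintegral_prod _ hKm.enorm.aemeasurable]
    have : ∀ x, ∫⁻ s, ‖K (x, s)‖ₑ = ‖x * toGauss μ x‖ₑ := by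
      intro x
      simp only [K, enorm_mul]
      rw [lintegral_const_mul' _ _ enorm_ne_top, lintegral_enorm_indicator_Iio_sub, mul_comm]
    simp_rw [this]
    exact hxT.2
  have h1 : ∀ s, ∫ x, K (x, s) ∂μ = ∫ x in Ioi s, toGauss μ x ∂μ := by
    intro s
    have : ∀ x, K (x, s) = (Ioi s).indicator (toGauss μ) x -
        toGauss μ x * (Iio (0 : ℝ)).indicator 1 s := by
      intro x
      simp only [K, mul_sub]
      congr 1
      by_cases h : s < x <;> simp [h]
    simp_rw [this]
    rw [integral_sub (hT.indicator measurableSet_Ioi) (hT.mul_const _), integral_mul_const,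
      integral_toGauss, integral_indicator measurableSet_Ioi]
    simp
  constructor
  · simpa only [h1] using hK.integral_prod_right
  · have := integral_integral_swap (f := fun x s => K (x, s)) hK
    simp_rw [h1] at this
    rw [← this]
    refine integral_congr_ae (.of_forall fun x => ?_)
    simp only [K]
    rw [integral_const_mul, integral_indicator_Iio_sub, mul_comm]

/-! ### Pointwise logarithmic bounds. -/

lemma log_gaussianPDFReal_sub (x y : ℝ) :
    Real.log (gaussianPDFReal 0 1 x) - Real.log (gaussianPDFReal 0 1 y) = y ^ 2 / 2 - x ^ 2 / 2 := by
  have h : (√(2 * Real.pi * ((1 : NNReal) : ℝ)))⁻¹ ≠ 0 := by positivity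
  unfold gaussianPDFReal
  rw [Real.log_mul h (Real.exp_ne_zero _), Real.log_mul h (Real.exp_ne_zero _), Real.log_exp,
    Real.log_exp]
  simp
  ring

/-- This is log z ≤ z - 1 at z = v / (c w). The parameter c is kept free so that it can be optimised
after integration, when the inequality has become global. -/
lemma le_of_log_bound {v w c : ℝ} (hv : 0 < v) (hw : 0 < w) (hc : 0 < c) :
    c * w * (1 - Real.log c + Real.log v - Real.log w) ≤ v := by
  have h := Real.log_le_sub_one_of_pos (x := v / (c * w)) (by positivity)
  rw [Real.log_div hv.ne' (by positivity), Real.log_mul hc.ne' hw.ne'] at h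
  have h2 : 1 - Real.log c + Real.log v - Real.log w ≤ v / (c * w) := by linarith
  rw [le_div_iff₀ (by positivity)] at h2
  linarith

end Line

/-! ### Measures with a density -/

section Density

variable {E : Type*} [MeasurableSpace E] {ν : Measure E} {h : E → ℝ}

lemma IsProbDensity.integrable (hh : IsProbDensity ν h) : Integrable h ν := by
  by_contra hn
  have := hh.2.2
  rw [integral_undef hn] at this
  exact zero_ne_one this

lemma isProbabilityMeasure_densMeasure (hh : IsProbDensity ν h) :
    IsProbabilityMeasure (densMeasure ν h) := by
  refine ⟨?_⟩
  rw [densMeasure, withDensity_apply _ MeasurableSet.univ, Measure.restrict_univ,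
    ← ofReal_integral_eq_lintegral_ofReal hh.integrable (.of_forall hh.2.1), hh.2.2,
    ENNReal.ofReal_one]

lemma lintegral_densMeasure (hm : Measurable h) {f : E → ℝ≥0∞} (hf : Measurable f) :
    ∫⁻ x, f x ∂densMeasure ν h = ∫⁻ x, ENNReal.ofReal (h x) * f x ∂ν := by
  rw [densMeasure, lintegral_withDensity_eq_lintegral_mul _ hm.ennreal_ofReal hf]
  rfl

lemma integral_densMeasure (hm : Measurable h) (h0 : ∀ x, 0 ≤ h x) (f : E → ℝ) :
    ∫ x, f x ∂densMeasure ν h = ∫ x, h x * f x ∂ν := by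
  rw [densMeasure, integral_withDensity_eq_integral_toReal_smul hm.ennreal_ofReal (by simp)]
  simp [ENNReal.toReal_ofReal (h0 _)]

lemma integrable_densMeasure_iff (hm : Measurable h) (h0 : ∀ x, 0 ≤ h x) (f : E → ℝ) :
    Integrable f (densMeasure ν h) ↔ Integrable (fun x => h x * f x) ν := by
  rw [densMeasure, integrable_withDensity_iff hm.ennreal_ofReal (by simp)]
  simp [ENNReal.toReal_ofReal (h0 _), mul_comm]

end Density

/-- The correlation of a probability density on the line with its Gaussian transport is bounded
below in terms of the entropy. -/
lemma le_integral_mul_toGauss {k : ℝ → ℝ} (hk : IsProbDensity gaussLine k)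
    (hent : Integrable (fun t => k t * Real.log (k t)) gaussLine)
    (hmom : Integrable (fun t => k t * t ^ 2) gaussLine) {c : ℝ} (hc : 0 < c) :
    c * (1 / 2 - Real.log c + 1 / 2 * (∫ t, k t * t ^ 2 ∂gaussLine) -
      ∫ t, k t * Real.log (k t) ∂gaussLine) ≤
      ∫ t, k t * (t * toGauss (densMeasure gaussLine k) t) ∂gaussLine := by
  obtain ⟨hkm, hk0, hk1⟩ := id hk
  set μ := densMeasure gaussLine k with hμ
  have : IsProbabilityMeasure μ := isProbabilityMeasure_densMeasure hk
  have hac : μ ≪ gaussLine := withDensity_absolutelyContinuous _ _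
  have : NullSingletonClass μ := ⟨fun x => hac (measure_singleton x)⟩
  have hsq : Integrable (fun t : ℝ => t ^ 2) μ := (integrable_densMeasure_iff hkm hk0 _).2 hmom
  have h2 : MemLp id 2 μ := (memLp_two_iff_integrable_sq (by fun_prop)).2 hsq
  obtain ⟨hGi, hG⟩ := integrable_and_integral_mul_toGauss μ h2
  have hT2 : Integrable (fun t => k t * toGauss μ t ^ 2) gaussLine :=
    (integrable_densMeasure_iff hkm hk0 _).1 (memLp_toGauss μ).integrable_sq
  rw [← integral_densMeasure hkm hk0 (fun t => t * toGauss μ t), ← hμ, ← hG]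
  -- The integrated form of the logarithmic bound. The second moment of T is 1, which turns the
  -- constant 1 - log c into 1/2 - log c.
  let R : ℝ → ℝ := fun t => c * (k t * (1 - Real.log c) + k t * t ^ 2 * (1 / 2) -
    k t * toGauss μ t ^ 2 * (1 / 2) - k t * Real.log (k t))
  have hRi : Integrable R gaussLine :=
    ((((hk.integrable.mul_const _).add (hmom.mul_const _)).sub (hT2.mul_const _)).sub
      hent).const_mul c
  have hRint : ∫ t, R t ∂gaussLine = c * (1 / 2 - Real.log c +
      1 / 2 * (∫ t, k t * t ^ 2 ∂gaussLine) - ∫ t, k t * Real.log (k t) ∂gaussLine) := by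
    have i1 : Integrable (fun t => k t * (1 - Real.log c)) gaussLine := hk.integrable.mul_const _
    have i2 : Integrable (fun t => k t * t ^ 2 * (1 / 2)) gaussLine := hmom.mul_const _
    have i3 : Integrable (fun t => k t * toGauss μ t ^ 2 * (1 / 2)) gaussLine := hT2.mul_const _
    have i4 := integral_densMeasure (ν := gaussLine) hkm hk0 (fun t => toGauss μ t ^ 2)
    rw [← hμ, integral_toGauss_sq μ] at i4
    simp only [R]
    rw [integral_const_mul, integral_sub (by exact (i1.add i2).sub i3) hent,
      integral_sub (by exact i1.add i2) i3, integral_add i1 i2, integral_mul_const,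
      integral_mul_const, integral_mul_const, hk1, ← i4]
    ring
  have hRi' : Integrable (fun t => gaussianPDFReal 0 1 t * R t) := by
    rw [gaussLine, gaussianReal_of_var_ne_zero 0 one_ne_zero,
      integrable_withDensity_iff (measurable_gaussianPDF 0 1) (by simp [gaussianPDF])] at hRi
    simpa [toReal_gaussianPDF, mul_comm] using hRi
  rw [← hRint, gaussLine, integral_gaussianReal_eq_integral_smul one_ne_zero]
  refine integral_mono_ae hRi' hGi ?_
  -- The tail moments are integrated against Lebesgue measure, so the almost sure statement under μ
  -- is transferred to Lebesgue-almost every point of {k ≠ 0}.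
  have hae : ∀ᵐ t ∂(volume : Measure ℝ), k t ≠ 0 → cdf μ t ∈ Ioo (0 : ℝ) 1 := by
    have h1 : ∀ᵐ t ∂gaussLine, ENNReal.ofReal (k t) ≠ 0 → cdf μ t ∈ Ioo (0 : ℝ) 1 :=
      (ae_withDensity_iff hkm.ennreal_ofReal).1 (ae_cdf_mem μ)
    filter_upwards [(gaussianReal_absolutelyContinuous' 0 one_ne_zero).ae_le h1] with t ht hkt
    exact ht (by simpa using lt_of_le_of_ne (hk0 t) hkt.symm)
  filter_upwards [hae] with t ht
  rcases (hk0 t).eq_or_lt with h0 | h0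
  · simpa [R, ← h0] using setIntegral_Ioi_toGauss_nonneg μ t
  · have hs := ht h0.ne'
    rw [setIntegral_Ioi_toGauss μ hs]
    have hp := gaussianPDFReal_pos 0 1 t one_ne_zero
    -- Here v = φ(T) and w = φk. For a smooth T the change of variables would make v / w equal to 1
    -- / T'.
    have hb := le_of_log_bound (gaussianPDFReal_pos 0 1 (toGauss μ t) one_ne_zero)
      (mul_pos hp h0) hc
    rw [Real.log_mul hp.ne' h0.ne'] at hb
    have hl := log_gaussianPDFReal_sub (toGauss μ t) t
    refine le_trans (le_of_eq ?_) hb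
    rw [show (1 - Real.log c + Real.log (gaussianPDFReal 0 1 (toGauss μ t)) -
      (Real.log (gaussianPDFReal 0 1 t) + Real.log (k t))) = 1 - Real.log c +
      (t ^ 2 / 2 - toGauss μ t ^ 2 / 2) - Real.log (k t) by rw [← hl]; ring]
    simp only [R, smul_eq_mul]
    ring

/-! ### Triangular transport -/

lemma isProbDensity_div_integral {E : Type*} [MeasurableSpace E] {ν : Measure E} {k : E → ℝ}
    (hm : Measurable k) (h0 : ∀ x, 0 ≤ k x) (hpos : 0 < ∫ x, k x ∂ν) :
    IsProbDensity ν (fun x => k x / ∫ y, k y ∂ν) :=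
  ⟨hm.div_const _, fun x => div_nonneg (h0 x) hpos.le, by
    rw [integral_div, div_self hpos.ne']⟩

lemma neg_one_le_mul_log {u : ℝ} (hu : 0 ≤ u) : -1 ≤ u * Real.log u := by
  rcases hu.eq_or_lt with rfl | hu
  · simp
  · have h := Real.one_sub_inv_le_log_of_pos hu
    have h2 := mul_le_mul_of_nonneg_left h hu.le
    rw [mul_sub, mul_inv_cancel₀ hu.ne'] at h2
    linarith

/-- Jensen's inequality for `u log u`. -/
lemma integral_mul_log_integral_le {E : Type*} [MeasurableSpace E] {ν : Measure E}
    [IsProbabilityMeasure ν] {k : E → ℝ} (h0 : ∀ x, 0 ≤ k x) (hk : Integrable k ν)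
    (hent : Integrable (fun x => k x * Real.log (k x)) ν) :
    (∫ x, k x ∂ν) * Real.log (∫ x, k x ∂ν) ≤ ∫ x, k x * Real.log (k x) ∂ν :=
  Real.convexOn_mul_log.map_integral_le Real.continuous_mul_log.continuousOn isClosed_Ici
    (.of_forall h0) hk hent

/-- Young's inequality for the pair `u log u`, `exp`. -/
lemma mul_le_mul_log_add_exp {a b : ℝ} (ha : 0 ≤ a) : a * b ≤ a * Real.log a - a + Real.exp b := by
  rcases ha.eq_or_lt with rfl | ha
  · simpa using (Real.exp_pos b).le
  · have h := Real.add_one_le_exp (b - Real.log a)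
    rw [Real.exp_sub, Real.exp_log ha, le_div_iff₀ ha] at h
    linarith

lemma integrable_mul_of_integrable_exp {E : Type*} [MeasurableSpace E] {ν : Measure E}
    {h b : E → ℝ} (hm : Measurable h) (h0 : ∀ x, 0 ≤ h x) (hh : Integrable h ν)
    (hent : Integrable (fun x => h x * Real.log (h x)) ν) (hb : Measurable b)
    (hb0 : ∀ x, 0 ≤ b x) (hexp : Integrable (fun x => Real.exp (b x)) ν) :
    Integrable (fun x => h x * b x) ν := by
  refine ((hent.sub hh).add hexp).mono' (hm.mul hb).aestronglyMeasurable (.of_forall fun x => ?_)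
  rw [Real.norm_of_nonneg (mul_nonneg (h0 x) (hb0 x))]
  exact mul_le_mul_log_add_exp (h0 x)

/-- The rate 1/4 lies below the Gaussian rate 1/2. Through Young's inequality, this makes second
moments finite for every density of finite entropy. -/
lemma integrable_exp_sq_gaussLine : Integrable (fun t : ℝ => Real.exp (t ^ 2 / 4)) gaussLine := by
  rw [gaussLine, gaussianReal_of_var_ne_zero 0 one_ne_zero,
    integrable_withDensity_iff (measurable_gaussianPDF 0 1) (by simp [gaussianPDF])]
  have := (integrable_exp_neg_mul_sq (b := 1 / 4) (by norm_num)).const_mul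
    (√(2 * Real.pi * ((1 : NNReal) : ℝ)))⁻¹
  refine this.congr (.of_forall fun t => ?_)
  simp only [toReal_gaussianPDF, gaussianPDFReal]
  rw [mul_left_comm, ← Real.exp_add]
  congr 2
  simp
  ring

/-- The lower bound for the correlation with the Gaussian transport, for a density of arbitrary
mass. -/
lemma le_integral_mul_toGauss_of_mass {k : ℝ → ℝ} (hm : Measurable k) (h0 : ∀ x, 0 ≤ k x)
    (hk : Integrable k gaussLine) (hpos : 0 < ∫ t, k t ∂gaussLine)
    (hent : Integrable (fun t => k t * Real.log (k t)) gaussLine)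
    (hmom : Integrable (fun t => k t * t ^ 2) gaussLine) {c : ℝ} (hc : 0 < c) :
    c * ((∫ t, k t ∂gaussLine) * (1 / 2 - Real.log c) + 1 / 2 * (∫ t, k t * t ^ 2 ∂gaussLine) -
      (∫ t, k t * Real.log (k t) ∂gaussLine) +
        (∫ t, k t ∂gaussLine) * Real.log (∫ t, k t ∂gaussLine)) ≤
      ∫ t, k t * (t * toGauss (densMeasure gaussLine
        fun s => k s / ∫ r, k r ∂gaussLine) t) ∂gaussLine := by
  set m := ∫ t, k t ∂gaussLine with hmdef
  have hd := isProbDensity_div_integral hm h0 hpos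
  rw [← hmdef] at hd
  have hlog : ∀ t, k t / m * Real.log (k t / m) =
      k t * Real.log (k t) / m - k t * (Real.log m / m) := by
    intro t
    rcases (h0 t).eq_or_lt with h | h
    · simp [← h]
    · rw [Real.log_div h.ne' hpos.ne']; field_simp
  have i1 : Integrable (fun t => k t * Real.log (k t) / m) gaussLine := hent.div_const _
  have i2 : Integrable (fun t => k t * (Real.log m / m)) gaussLine := hk.mul_const _
  have hmul : ∀ a t, k t / m * a = k t * a / m := fun a t => by ring
  have key := le_integral_mul_toGauss hd (by simp_rw [hlog]; exact i1.sub i2)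
    (by simp_rw [hmul]; exact hmom.div_const _) hc
  simp_rw [hlog] at key
  rw [integral_sub i1 i2] at key
  simp_rw [hmul] at key
  rw [integral_div, integral_div, integral_div, integral_mul_const, ← hmdef, le_div_iff₀ hpos] at key
  refine le_trans (le_of_eq ?_) key
  field_simp
  ring

section Product

variable {E : Type*} [MeasurableSpace E] {ν : Measure E} [IsProbabilityMeasure ν] {h : ℝ × E → ℝ}

/-- The marginal density on the second factor. -/
def marginal (h : ℝ × E → ℝ) (x : E) : ℝ := ∫ t, h (t, x) ∂gaussLine

/-- The transport of the first coordinate to the standard Gaussian measure, conditionally on the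
second one. -/
def condTransport (h : ℝ × E → ℝ) (p : ℝ × E) : ℝ :=
  gaussQuantile ((∫ s, (Iic p.1).indicator (fun s => h (s, p.2)) s ∂gaussLine) / marginal h p.2)

lemma measurable_marginal (hm : Measurable h) : Measurable (marginal h) :=
  (hm.stronglyMeasurable.integral_prod_left' (μ := gaussLine)).measurable

lemma measurable_condTransport (hm : Measurable h) : Measurable (condTransport h) := by
  refine measurable_gaussQuantile.comp (Measurable.div ?_
    ((measurable_marginal hm).comp measurable_snd))
  have : Measurable fun q : ℝ × (ℝ × E) =>
      (Iic q.2.1).indicator (fun s => h (s, q.2.2)) q.1 := by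
    have e : (fun q : ℝ × (ℝ × E) => (Iic q.2.1).indicator (fun s => h (s, q.2.2)) q.1) =
        {q : ℝ × (ℝ × E) | q.1 ≤ q.2.1}.indicator (fun q => h (q.1, q.2.2)) := by
      ext q; simp [indicator_apply]
    rw [e]
    exact (hm.comp (by fun_prop)).indicator (measurableSet_le (by fun_prop) (by fun_prop))
  exact (this.stronglyMeasurable.integral_prod_left' (μ := gaussLine)).measurable

lemma condTransport_eq_toGauss (hm : Measurable h) (h0 : ∀ p, 0 ≤ h p) {x : E}
    (hpos : 0 < marginal h x) (t : ℝ) :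
    condTransport h (t, x) =
      toGauss (densMeasure gaussLine fun s => h (s, x) / marginal h x) t := by
  have hd : IsProbDensity gaussLine (fun s => h (s, x) / marginal h x) :=
    isProbDensity_div_integral (hm.comp (by fun_prop)) (fun s => h0 _) hpos
  have := isProbabilityMeasure_densMeasure hd
  rw [condTransport, toGauss, cdf_eq_real, ← integral_indicator_one measurableSet_Iic,
    integral_densMeasure hd.1 hd.2.1, ← integral_div]
  congr 2
  ext s
  by_cases hs : s ≤ t <;> simp [hs]

lemma isProbDensity_marginal (hh : IsProbDensity (gaussLine.prod ν) h) :
    IsProbDensity ν (marginal h) := by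
  refine ⟨measurable_marginal hh.1, fun x => integral_nonneg fun t => hh.2.1 _, ?_⟩
  rw [← hh.2.2, integral_prod_symm _ hh.integrable]
  rfl

/-- The conditional transport turns the first coordinate into a standard Gaussian that is
independent of the second coordinate. -/
lemma map_condTransport (hh : IsProbDensity (gaussLine.prod ν) h) :
    (densMeasure (gaussLine.prod ν) h).map (fun p => (condTransport h p, p.2)) =
      gaussLine.prod (densMeasure ν (marginal h)) := by
  obtain ⟨hm, h0, h1⟩ := id hh
  have hT := measurable_condTransport hm
  have hmarg := isProbDensity_marginal hh
  have := isProbabilityMeasure_densMeasure hmarg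
  refine Measure.ext_of_lintegral _ fun f hf => ?_
  have hf' : Measurable fun p : ℝ × E => f (condTransport h p, p.2) :=
    hf.comp (hT.prodMk measurable_snd)
  rw [lintegral_map hf (hT.prodMk measurable_snd), lintegral_densMeasure hm hf',
    lintegral_prod_symm _ (by exact (hm.ennreal_ofReal.mul hf').aemeasurable),
    lintegral_prod_symm _ hf.aemeasurable,
    lintegral_densMeasure hmarg.1 (Measurable.lintegral_prod_left' hf)]
  refine lintegral_congr_ae ?_
  filter_upwards [hh.integrable.prod_left_ae] with x hx
  have hmx : Measurable fun t => h (t, x) := hm.comp (by fun_prop)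
  have hfx : Measurable fun t => f (t, x) := hf.comp (by fun_prop)
  -- On a fibre of zero mass the conditional law is a division by zero, but h vanishes almost
  -- everywhere there and both sides are zero.
  rcases (hmarg.2.1 x).eq_or_lt with h0x | hpos
  · have hz : (fun t => h (t, x)) =ᵐ[gaussLine] 0 :=
      (integral_eq_zero_iff_of_nonneg (fun t => h0 _) hx).1 h0x.symm
    rw [← h0x, ENNReal.ofReal_zero, zero_mul, lintegral_eq_zero_iff' (by fun_prop)]
    filter_upwards [hz] with t ht
    simp only [Pi.zero_apply] at ht
    simp [ht]
  · have hd : IsProbDensity gaussLine (fun s => h (s, x) / marginal h x) :=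
      isProbDensity_div_integral hmx (fun s => h0 _) hpos
    set μ := densMeasure gaussLine (fun s => h (s, x) / marginal h x) with hμ
    have : IsProbabilityMeasure μ := isProbabilityMeasure_densMeasure hd
    have hac : μ ≪ gaussLine := withDensity_absolutelyContinuous _ _
    have : NullSingletonClass μ := ⟨fun x => hac (measure_singleton x)⟩
    have e1 : ∀ t, ENNReal.ofReal (h (t, x)) * f (condTransport h (t, x), x) =
        ENNReal.ofReal (marginal h x) *
          (ENNReal.ofReal (h (t, x) / marginal h x) * f (toGauss μ t, x)) := by
      intro t
      rw [condTransport_eq_toGauss hm h0 hpos, ← mul_assoc, ← ENNReal.ofReal_mul hpos.le,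
        mul_div_cancel₀ _ hpos.ne']
    simp_rw [e1]
    rw [lintegral_const_mul' _ _ ENNReal.ofReal_ne_top]
    congr 1
    rw [← lintegral_densMeasure hd.1 (f := fun t => f (toGauss μ t, x))
      (hfx.comp (measurable_toGauss μ)), ← hμ]
    exact (measurePreserving_toGauss μ).lintegral_comp hfx

lemma integrable_marginal_mul_log (hh : IsProbDensity (gaussLine.prod ν) h)
    (hent : Integrable (fun p => h p * Real.log (h p)) (gaussLine.prod ν)) :
    Integrable (fun x => marginal h x * Real.log (marginal h x)) ν := by
  have hmm := measurable_marginal hh.1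
  refine (hent.integral_prod_right.norm.add (integrable_const (1 : ℝ))).mono'
    (hmm.mul (Real.measurable_log.comp hmm)).aestronglyMeasurable ?_
  filter_upwards [hh.integrable.prod_left_ae, hent.prod_left_ae] with x hx hx'
  -- Jensen bounds m log m from above by the fibre integral of h log h; the bound -1 controls it
  -- from below.
  have h1 := integral_mul_log_integral_le (fun t => hh.2.1 (t, x)) hx hx'
  have h2 := neg_one_le_mul_log ((isProbDensity_marginal hh).2.1 x)
  rw [Real.norm_eq_abs, abs_le]
  have h3 := le_abs_self (∫ t, h (t, x) * Real.log (h (t, x)) ∂gaussLine)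
  have h4 := abs_nonneg (∫ t, h (t, x) * Real.log (h (t, x)) ∂gaussLine)
  simp only [Pi.add_apply, Real.norm_eq_abs]
  change marginal h x * Real.log (marginal h x) ≤ _ at h1
  constructor <;> linarith

lemma measurePreserving_condTransport (hh : IsProbDensity (gaussLine.prod ν) h) :
    MeasurePreserving (condTransport h) (densMeasure (gaussLine.prod ν) h) gaussLine := by
  have := isProbabilityMeasure_densMeasure (isProbDensity_marginal hh)
  have hT := measurable_condTransport hh.1
  have hp : MeasurePreserving (fun p : ℝ × E => (condTransport h p, p.2)) _ _ :=
    ⟨hT.prodMk measurable_snd, map_condTransport hh⟩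
  exact measurePreserving_fst.comp hp

lemma measurePreserving_snd_densMeasure (hh : IsProbDensity (gaussLine.prod ν) h) :
    MeasurePreserving Prod.snd (densMeasure (gaussLine.prod ν) h) (densMeasure ν (marginal h)) := by
  have := isProbabilityMeasure_densMeasure (isProbDensity_marginal hh)
  have hT := measurable_condTransport hh.1
  have hp : MeasurePreserving (fun p : ℝ × E => (condTransport h p, p.2)) _ _ :=
    ⟨hT.prodMk measurable_snd, map_condTransport hh⟩
  have hs : MeasurePreserving Prod.snd (gaussLine.prod (densMeasure ν (marginal h)))
    (densMeasure ν (marginal h)) := measurePreserving_snd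
  exact (hs.comp hp :)

lemma integrable_mul_fst_sq (hh : IsProbDensity (gaussLine.prod ν) h)
    (hent : Integrable (fun p => h p * Real.log (h p)) (gaussLine.prod ν)) :
    Integrable (fun p => h p * p.1 ^ 2) (gaussLine.prod ν) := by
  have := integrable_mul_of_integrable_exp hh.1 hh.2.1 hh.integrable hent
    (b := fun p => p.1 ^ 2 / 4) (by fun_prop) (fun p => by positivity)
    (integrable_exp_sq_gaussLine.comp_fst ν)
  refine (this.const_mul 4).congr (.of_forall fun p => ?_)
  ring

/-- The one-dimensional bound is integrated over the fibres with the same c. Normalising a fibre of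
mass m produces m log m, and these terms form the marginal entropy: this is the chain rule for the
entropy. -/
lemma le_integral_mul_condTransport (hh : IsProbDensity (gaussLine.prod ν) h)
    (hent : Integrable (fun p => h p * Real.log (h p)) (gaussLine.prod ν)) {c : ℝ} (hc : 0 < c) :
    c * (1 / 2 - Real.log c + 1 / 2 * (∫ p, h p * p.1 ^ 2 ∂gaussLine.prod ν) -
      (∫ p, h p * Real.log (h p) ∂gaussLine.prod ν) +
        ∫ x, marginal h x * Real.log (marginal h x) ∂ν) ≤
      ∫ p, h p * (p.1 * condTransport h p) ∂gaussLine.prod ν := by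
  obtain ⟨hm, h0, h1⟩ := id hh
  have hmom := integrable_mul_fst_sq hh hent
  have hmarg := isProbDensity_marginal hh
  have hml := integrable_marginal_mul_log hh hent
  have hT2 : MemLp (condTransport h) 2 (densMeasure (gaussLine.prod ν) h) :=
    (memLp_id_gaussianReal' 2 (by simp)).comp_measurePreserving
      (measurePreserving_condTransport hh)
  have hx2 : MemLp Prod.fst 2 (densMeasure (gaussLine.prod ν) h) :=
    (memLp_two_iff_integrable_sq (by fun_prop)).2 ((integrable_densMeasure_iff hm h0 _).2 hmom)
  have hI : Integrable (fun p => h p * (p.1 * condTransport h p)) (gaussLine.prod ν) :=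
    (integrable_densMeasure_iff hm h0 _).1 (hx2.integrable_mul hT2)
  have a1 : Integrable (fun x => marginal h x * (1 / 2 - Real.log c)) ν :=
    hmarg.integrable.mul_const _
  have a2 : Integrable (fun x => 1 / 2 * ∫ t, h (t, x) * t ^ 2 ∂gaussLine) ν :=
    hmom.integral_prod_right.const_mul _
  have a3 : Integrable (fun x => ∫ t, h (t, x) * Real.log (h (t, x)) ∂gaussLine) ν :=
    hent.integral_prod_right
  have hL : ∫ x, c * (marginal h x * (1 / 2 - Real.log c) +
      1 / 2 * (∫ t, h (t, x) * t ^ 2 ∂gaussLine) -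
      (∫ t, h (t, x) * Real.log (h (t, x)) ∂gaussLine) +
      marginal h x * Real.log (marginal h x)) ∂ν = c * (1 / 2 - Real.log c +
      1 / 2 * (∫ p, h p * p.1 ^ 2 ∂gaussLine.prod ν) -
      (∫ p, h p * Real.log (h p) ∂gaussLine.prod ν) +
        ∫ x, marginal h x * Real.log (marginal h x) ∂ν) := by
    rw [integral_const_mul, integral_add (by exact (a1.add a2).sub a3) hml,
      integral_sub (by exact a1.add a2) a3, integral_add a1 a2, integral_mul_const,
      integral_const_mul, hmarg.2.2, one_mul, integral_prod_symm _ hmom,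
      integral_prod_symm _ hent]
  rw [← hL, integral_prod_symm _ hI]
  refine integral_mono_ae ((((a1.add a2).sub a3).add hml).const_mul c) hI.integral_prod_right ?_
  filter_upwards [hh.integrable.prod_left_ae, hent.prod_left_ae, hmom.prod_left_ae]
    with x hx1 hx2 hx3
  have hmx : Measurable fun t => h (t, x) := hm.comp (by fun_prop)
  rcases (hmarg.2.1 x).eq_or_lt with h0x | hpos
  · have hz : (fun t => h (t, x)) =ᵐ[gaussLine] 0 :=
      (integral_eq_zero_iff_of_nonneg (fun t => h0 _) hx1).1 h0x.symm
    have z : ∀ g : ℝ → ℝ, ∫ t, h (t, x) * g t ∂gaussLine = 0 := fun g => by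
      refine integral_eq_zero_of_ae ?_
      filter_upwards [hz] with t ht
      simp only [Pi.zero_apply] at ht
      simp [ht]
    simp only [← h0x, z (fun t => t ^ 2), z (fun t => Real.log (h (t, x))),
      z (fun t => t * condTransport h (t, x))]
    simp
  · simp_rw [condTransport_eq_toGauss hm h0 hpos]
    exact le_integral_mul_toGauss_of_mass hmx (fun t => h0 _) hx1 hpos hx2 hx3 hc

end Product

/-! ### Correlation bound for the standard Gaussian measure on `Fin n → ℝ` -/

/-- The standard Gaussian measure on `Fin n → ℝ`. -/
abbrev gaussPi (n : ℕ) : Measure (Fin n → ℝ) := Measure.pi fun _ => gaussLine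

lemma integrable_mul_coord_sq {n : ℕ} {h : (Fin n → ℝ) → ℝ} (hh : IsProbDensity (gaussPi n) h)
    (hent : Integrable (fun x => h x * Real.log (h x)) (gaussPi n)) (i : Fin n) :
    Integrable (fun x => h x * x i ^ 2) (gaussPi n) := by
  have := integrable_mul_of_integrable_exp hh.1 hh.2.1 hh.integrable hent
    (b := fun x : Fin n → ℝ => x i ^ 2 / 4) (by fun_prop) (fun x => by positivity)
    ((measurePreserving_eval (fun _ : Fin n => gaussLine) i).integrable_comp_of_integrable
      integrable_exp_sq_gaussLine)
  refine (this.const_mul 4).congr (.of_forall fun p => ?_)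
  ring

lemma memLp_coord_densMeasure {n : ℕ} {h : (Fin n → ℝ) → ℝ} (hh : IsProbDensity (gaussPi n) h)
    (hent : Integrable (fun x => h x * Real.log (h x)) (gaussPi n)) (i : Fin n) :
    MemLp (fun x => x i) 2 (densMeasure (gaussPi n) h) :=
  (memLp_two_iff_integrable_sq (measurable_pi_apply i).aestronglyMeasurable).2
    ((integrable_densMeasure_iff hh.1 hh.2.1 _).2 (integrable_mul_coord_sq hh hent i))

lemma memLp_coord_comp {n : ℕ} {Ω : Type*} [MeasurableSpace Ω] {μ : Measure Ω}
    {T : Ω → Fin n → ℝ} (hT : MeasurePreserving T μ (gaussPi n)) (i : Fin n) :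
    MemLp (fun ω => T ω i) 2 μ :=
  (memLp_id_gaussianReal' 2 (by simp)).comp_measurePreserving
    ((measurePreserving_eval (fun _ : Fin n => gaussLine) i).comp hT)

lemma densMeasure_comp_measurableEquiv {E F : Type*} [MeasurableSpace E] [MeasurableSpace F]
    {ν : Measure E} {ν' : Measure F} {e : E ≃ᵐ F} (he : MeasurePreserving e ν ν') {h : E → ℝ}
    (hm : Measurable h) :
    MeasurePreserving e (densMeasure ν h) (densMeasure ν' (h ∘ e.symm)) := by
  refine ⟨e.measurable, Measure.ext_of_lintegral _ fun f hf => ?_⟩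
  rw [lintegral_map hf e.measurable, lintegral_densMeasure hm (f := fun x => f (e x)) (hf.comp e.measurable),
    lintegral_densMeasure (hm.comp e.symm.measurable) hf, ← he.lintegral_comp_emb
      e.measurableEmbedding]
  simp

/-- Triangular transport of a probability density of finite entropy to the standard Gaussian
measure, with a lower bound for the correlation. -/
theorem exists_transport (n : ℕ) (h : (Fin n → ℝ) → ℝ) (hh : IsProbDensity (gaussPi n) h)
    (hent : Integrable (fun x => h x * Real.log (h x)) (gaussPi n)) :
    ∃ T : (Fin n → ℝ) → Fin n → ℝ,
      MeasurePreserving T (densMeasure (gaussPi n) h) (gaussPi n) ∧ ∀ c : ℝ, 0 < c →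
      c * (n * (1 / 2 - Real.log c) + 1 / 2 * (∫ x, ∑ i, x i ^ 2 ∂densMeasure (gaussPi n) h) -
        ∫ x, h x * Real.log (h x) ∂gaussPi n) ≤
        ∫ x, ∑ i, x i * T x i ∂densMeasure (gaussPi n) h := by
  induction n with
  | zero =>
    have h1 : ∀ x, h x = 1 := by
      intro x
      have h2 := hh.2.2
      rwa [integral_congr_ae (.of_forall fun y => congrArg h (Subsingleton.elim y x)),
        integral_const, probReal_univ, one_smul] at h2
    refine ⟨id, ⟨measurable_id, ?_⟩, fun c hc => ?_⟩
    · have : h = fun _ => 1 := funext h1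
      rw [Measure.map_id, this, densMeasure]
      simp
    · simp [h1]
  | succ n ih =>
    let e : (Fin (n + 1) → ℝ) ≃ᵐ ℝ × (Fin n → ℝ) := MeasurableEquiv.piFinSuccAbove (fun _ => ℝ) 0
    have he : MeasurePreserving e (gaussPi (n + 1)) (gaussLine.prod (gaussPi n)) :=
      measurePreserving_piFinSuccAbove (fun _ => gaussLine) 0
    have hes : MeasurePreserving e.symm (gaussLine.prod (gaussPi n)) (gaussPi (n + 1)) :=
      he.symm e
    have he0 : ∀ x, (e x).1 = x 0 := fun x => rfl
    have he1 : ∀ x i, (e x).2 i = x (Fin.succ i) := fun x i => rfl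
    have hs0 : ∀ p, e.symm p 0 = p.1 := fun p => by rw [← he0 (e.symm p), e.apply_symm_apply]
    have hs1 : ∀ p i, e.symm p (Fin.succ i) = p.2 i := fun p i => by
      rw [← he1 (e.symm p), e.apply_symm_apply]
    let k : ℝ × (Fin n → ℝ) → ℝ := h ∘ e.symm
    have hk : IsProbDensity (gaussLine.prod (gaussPi n)) k := by
      refine ⟨hh.1.comp e.symm.measurable, fun p => hh.2.1 _, ?_⟩
      rw [← hh.2.2]
      exact hes.integral_comp e.symm.measurableEmbedding h
    have hkent : Integrable (fun p => k p * Real.log (k p)) (gaussLine.prod (gaussPi n)) :=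
      (hes.integrable_comp_emb e.symm.measurableEmbedding).2 hent
    have hkeq : ∫ p, k p * Real.log (k p) ∂gaussLine.prod (gaussPi n) =
        ∫ x, h x * Real.log (h x) ∂gaussPi (n + 1) :=
      hes.integral_comp e.symm.measurableEmbedding (fun x => h x * Real.log (h x))
    have hed : MeasurePreserving e (densMeasure (gaussPi (n + 1)) h)
        (densMeasure (gaussLine.prod (gaussPi n)) k) := densMeasure_comp_measurableEquiv he hh.1
    have hmarg := isProbDensity_marginal hk
    have hment := integrable_marginal_mul_log hk hkent
    obtain ⟨T', hT', hT'c⟩ := ih (marginal k) hmarg hment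
    have := isProbabilityMeasure_densMeasure hmarg
    have hpair : MeasurePreserving (fun p : ℝ × (Fin n → ℝ) => (condTransport k p, p.2))
        (densMeasure (gaussLine.prod (gaussPi n)) k)
        (gaussLine.prod (densMeasure (gaussPi n) (marginal k))) :=
      ⟨(measurable_condTransport hk.1).prodMk measurable_snd, map_condTransport hk⟩
    -- The conditional transport decouples the first coordinate from the others, so the inductive
    -- map can act on the remaining ones alone.
    have hT : MeasurePreserving (fun x => e.symm (condTransport k (e x), T' (e x).2))
        (densMeasure (gaussPi (n + 1)) h) (gaussPi (n + 1)) :=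
      hes.comp ((((MeasurePreserving.id gaussLine).prod hT').comp hpair).comp hed)
    have hsnd : MeasurePreserving (fun x => (e x).2) (densMeasure (gaussPi (n + 1)) h)
        (densMeasure (gaussPi n) (marginal k)) := (measurePreserving_snd_densMeasure hk).comp hed
    have hX := memLp_coord_densMeasure hh hent
    have hTL := memLp_coord_comp hT
    refine ⟨_, hT, fun c hc => ?_⟩
    -- The marginal entropy enters this bound with a plus sign and the inductive bound with a minus
    -- sign, so it cancels in the sum.
    have b1 := le_integral_mul_condTransport hk hkent hc
    have b2 := hT'c c hc
    rw [hkeq, ← integral_densMeasure hk.1 hk.2.1, ← integral_densMeasure hk.1 hk.2.1,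
      ← hed.integral_comp e.measurableEmbedding, ← hed.integral_comp e.measurableEmbedding] at b1
    have c1 : ∫ x, ∑ i, x i ^ 2 ∂densMeasure (gaussPi n) (marginal k) =
        ∫ x, ∑ i : Fin n, x i.succ ^ 2 ∂densMeasure (gaussPi (n + 1)) h := by
      rw [← hsnd.map_eq, integral_map hsnd.measurable.aemeasurable
        (Measurable.aestronglyMeasurable (by fun_prop))]
      rfl
    have c2 : ∫ x, ∑ i, x i * T' x i ∂densMeasure (gaussPi n) (marginal k) =
        ∫ x, ∑ i : Fin n, x i.succ * T' (e x).2 i ∂densMeasure (gaussPi (n + 1)) h := by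
      have : Measurable fun x : Fin n → ℝ => ∑ i, x i * T' x i :=
        Finset.measurable_sum _ fun i _ => (measurable_pi_apply i).mul
          ((measurable_pi_apply i).comp hT'.measurable)
      rw [← hsnd.map_eq, integral_map hsnd.measurable.aemeasurable this.aestronglyMeasurable]
      rfl
    rw [c1, c2] at b2
    simp_rw [Fin.sum_univ_succ, hs0, hs1]
    have d0 : Integrable (fun x => x 0 * condTransport k (e x)) (densMeasure (gaussPi (n + 1)) h) :=
      (hX 0).integrable_mul (by simpa only [hs0] using hTL 0)
    have d1 : Integrable (fun x => ∑ i : Fin n, x i.succ * T' (e x).2 i)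
        (densMeasure (gaussPi (n + 1)) h) :=
      integrable_finsetSum _ fun i _ => (hX (Fin.succ i)).integrable_mul
        (by simpa only [hs1] using hTL (Fin.succ i))
    rw [integral_add (hX 0).integrable_sq
      (integrable_finsetSum _ fun i _ => (hX (Fin.succ i)).integrable_sq), integral_add d0 d1]
    simp only [he0] at b1
    push_cast
    linarith

/-! ### Talagrand's inequality -/

lemma W2_sq_le_of_isCoupling {E : Type*} [PseudoEMetricSpace E] [MeasurableSpace E]
    {μ ν : Measure E} {π : Measure (E × E)} (hπ : IsCoupling π μ ν) :
    W2 μ ν ^ 2 ≤ ∫⁻ p, edist p.1 p.2 ^ 2 / 2 ∂π := by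
  have h : W2 μ ν ≤ (∫⁻ p, edist p.1 p.2 ^ 2 / 2 ∂π) ^ (1 / 2 : ℝ) := iInf₂_le π hπ
  calc W2 μ ν ^ 2 ≤ ((∫⁻ p, edist p.1 p.2 ^ 2 / 2 ∂π) ^ (1 / 2 : ℝ)) ^ 2 := by gcongr
    _ = _ := by
      rw [← ENNReal.rpow_natCast, ← ENNReal.rpow_mul]
      norm_num

lemma isCoupling_map {E : Type*} [MeasurableSpace E] {μ ν : Measure E} {T : E → E} (hT : MeasurePreserving T μ ν) :
    IsCoupling (μ.map fun x => (x, T x)) μ ν := by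
  constructor
  · rw [Measure.fst_map_prodMk hT.measurable, Measure.map_id']
  · rw [Measure.snd_map_prodMk measurable_id', hT.map_eq]

lemma isCoupling_prod {E : Type*} [MeasurableSpace E] {μ ν : Measure E} [IsProbabilityMeasure μ] [IsProbabilityMeasure ν] :
    IsCoupling (μ.prod ν) μ ν := ⟨by simp, by simp⟩

variable {n : ℕ}

/-! ### Moments of the Gaussian measure on Euclidean space. -/

lemma measurePreserving_toLp :
    MeasurePreserving (MeasurableEquiv.toLp 2 (Fin n → ℝ)) (gaussPi n) (gauss n) :=
  ⟨MeasurableEquiv.measurable _, map_pi_eq_stdGaussian⟩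

lemma edist_sq_div_two (x y : EuclideanSpace ℝ (Fin n)) :
    edist x y ^ 2 / 2 = ENNReal.ofReal (‖x - y‖ ^ 2 / 2) := by
  rw [edist_dist, dist_eq_norm, ENNReal.ofReal_div_of_pos two_pos, ENNReal.ofReal_pow (norm_nonneg _)]
  simp

lemma memLp_coord_gauss (i : Fin n) {p : ℝ≥0∞} (hp : p ≠ ∞) :
    MemLp (fun x : EuclideanSpace ℝ (Fin n) => x i) p (gauss n) := by
  have h : MeasurePreserving (fun x : EuclideanSpace ℝ (Fin n) => x i) (gauss n) gaussLine :=
    (measurePreserving_eval (fun _ : Fin n => gaussLine) i).comp (measurePreserving_toLp.symm _)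
  exact (memLp_id_gaussianReal' p hp).comp_measurePreserving h

lemma integral_coord_gauss (f : ℝ → ℝ) (hf : Measurable f) (i : Fin n) :
    ∫ x, f (x i) ∂gauss n = ∫ t, f t ∂gaussLine := by
  have h : MeasurePreserving (fun x : EuclideanSpace ℝ (Fin n) => x i) (gauss n) gaussLine :=
    (measurePreserving_eval (fun _ : Fin n => gaussLine) i).comp (measurePreserving_toLp.symm _)
  rw [← h.map_eq, integral_map h.measurable.aemeasurable hf.aestronglyMeasurable]

lemma integrable_norm_sq_gauss : Integrable (fun x => ‖x‖ ^ 2) (gauss n) := by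
  simp_rw [EuclideanSpace.real_norm_sq_eq]
  exact integrable_finsetSum _ fun i _ => (memLp_coord_gauss i (by simp)).integrable_sq

lemma integral_norm_sq_gauss : ∫ x, ‖x‖ ^ 2 ∂gauss n = n := by
  simp_rw [EuclideanSpace.real_norm_sq_eq]
  rw [integral_finsetSum _ fun i _ => (memLp_coord_gauss i (by simp)).integrable_sq]
  simp_rw [fun i => integral_coord_gauss (n := n) (fun t => t ^ 2) (by fun_prop) i,
    integral_sq_gaussLine]
  simp

lemma integrable_inner_gauss (x : EuclideanSpace ℝ (Fin n)) :
    Integrable (fun y => inner ℝ x y) (gauss n) := by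
  simp only [PiLp.inner_apply]
  exact integrable_finsetSum _ fun i _ =>
    ((memLp_coord_gauss i (p := 1) (by simp)).integrable le_rfl).mul_const _

/-- The bound given by the independent coupling. -/
lemma W2_sq_le_add {h : EuclideanSpace ℝ (Fin n) → ℝ} (hh : IsProbDensity (gauss n) h)
    (hmom : Integrable (fun x => h x * ‖x‖ ^ 2) (gauss n)) :
    W2 (densMeasure (gauss n) h) (gauss n) ^ 2 ≤
      ENNReal.ofReal (1 / 2 * (∫ x, h x * ‖x‖ ^ 2 ∂gauss n) + n / 2) := by
  have := isProbabilityMeasure_densMeasure hh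
  refine (W2_sq_le_of_isCoupling isCoupling_prod).trans (le_of_eq ?_)
  rw [lintegral_prod _ (by fun_prop)]
  have hx : ∀ x : EuclideanSpace ℝ (Fin n), ∫⁻ y, edist x y ^ 2 / 2 ∂gauss n =
      ENNReal.ofReal (‖x‖ ^ 2 / 2 + n / 2) := by
    intro x
    have e : ∀ y : EuclideanSpace ℝ (Fin n),
        ‖x - y‖ ^ 2 / 2 = ‖x‖ ^ 2 / 2 - inner ℝ x y + ‖y‖ ^ 2 / 2 := fun y => by
      rw [norm_sub_sq_real]; ring
    have i1 : Integrable (fun y => ‖x‖ ^ 2 / 2 - inner ℝ x y) (gauss n) :=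
      (integrable_const _).sub (integrable_inner_gauss x)
    have i2 : Integrable (fun y : EuclideanSpace ℝ (Fin n) => ‖y‖ ^ 2 / 2) (gauss n) :=
      integrable_norm_sq_gauss.div_const 2
    -- The cross term of the independent coupling vanishes because γ is centred.
    have hz : ∫ y, inner ℝ x y ∂gauss n = 0 := integral_strongDual_stdGaussian (innerSL ℝ x)
    simp_rw [edist_sq_div_two]
    rw [← ofReal_integral_eq_lintegral_ofReal
      ((i1.add i2).congr (.of_forall fun y => (e y).symm)) (.of_forall fun y => by positivity)]
    simp_rw [e]
    rw [integral_add i1 i2, integral_sub (integrable_const _) (integrable_inner_gauss x), hz,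
      integral_div 2 (fun y : EuclideanSpace ℝ (Fin n) => ‖y‖ ^ 2), integral_norm_sq_gauss]
    simp
  simp_rw [hx]
  have hI : Integrable (fun x => ‖x‖ ^ 2) (densMeasure (gauss n) h) :=
    (integrable_densMeasure_iff hh.1 hh.2.1 _).2 hmom
  have hI2 : Integrable (fun x : EuclideanSpace ℝ (Fin n) => ‖x‖ ^ 2 / 2 + (n : ℝ) / 2)
    (densMeasure (gauss n) h) := (hI.div_const 2).add (integrable_const _)
  rw [← ofReal_integral_eq_lintegral_ofReal hI2
    (.of_forall fun y => by positivity), integral_add (hI.div_const 2) (integrable_const _),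
    integral_div, integral_densMeasure hh.1 hh.2.1]
  simp
  congr 1
  ring

lemma integrable_mul_norm_sq {h : EuclideanSpace ℝ (Fin n) → ℝ} (hh : IsProbDensity (gauss n) h)
    (hent : Integrable (fun x => h x * Real.log (h x)) (gauss n)) :
    Integrable (fun x => h x * ‖x‖ ^ 2) (gauss n) := by
  simp_rw [EuclideanSpace.real_norm_sq_eq, Finset.mul_sum]
  refine integrable_finsetSum _ fun i _ => ?_
  have h1 : MeasurePreserving (fun x : EuclideanSpace ℝ (Fin n) => x i) (gauss n) gaussLine :=
    (measurePreserving_eval (fun _ : Fin n => gaussLine) i).comp (measurePreserving_toLp.symm _)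
  have := integrable_mul_of_integrable_exp hh.1 hh.2.1 hh.integrable hent
    (b := fun x : EuclideanSpace ℝ (Fin n) => x i ^ 2 / 4) (by fun_prop) (fun x => by positivity)
    (h1.integrable_comp_of_integrable integrable_exp_sq_gaussLine)
  refine (this.const_mul 4).congr (.of_forall fun p => ?_)
  ring

/-- A one-parameter family of transport-entropy inequalities; `c = 1` is Talagrand's inequality. -/
theorem W2_sq_le_entropy {h : EuclideanSpace ℝ (Fin n) → ℝ} (hh : IsProbDensity (gauss n) h)
    (hent : Integrable (fun x => h x * Real.log (h x)) (gauss n)) {c : ℝ} (hc : 0 < c) :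
    ((W2 (densMeasure (gauss n) h) (gauss n) ^ 2 : ℝ≥0∞) : EReal) ≤
      ((1 / 2 * (∫ x, h x * ‖x‖ ^ 2 ∂gauss n) + n / 2 -
        c * (n * (1 / 2 - Real.log c) + 1 / 2 * (∫ x, h x * ‖x‖ ^ 2 ∂gauss n) -
          ∫ x, h x * Real.log (h x) ∂gauss n) : ℝ) : EReal) := by
  let e := MeasurableEquiv.toLp 2 (Fin n → ℝ)
  have he : MeasurePreserving e (gaussPi n) (gauss n) := measurePreserving_toLp
  have hes : MeasurePreserving e.symm (gauss n) (gaussPi n) := he.symm e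
  have hk : IsProbDensity (gaussPi n) (h ∘ e) :=
    ⟨hh.1.comp e.measurable, fun x => hh.2.1 _, by
      rw [← hh.2.2]; exact he.integral_comp e.measurableEmbedding h⟩
  have hkent : Integrable (fun x => (h ∘ e) x * Real.log ((h ∘ e) x)) (gaussPi n) :=
    (he.integrable_comp_emb e.measurableEmbedding).2 hent
  have hkeq : ∫ x, (h ∘ e) x * Real.log ((h ∘ e) x) ∂gaussPi n =
      ∫ x, h x * Real.log (h x) ∂gauss n :=
    he.integral_comp e.measurableEmbedding (fun x => h x * Real.log (h x))
  have hd : MeasurePreserving e.symm (densMeasure (gauss n) h) (densMeasure (gaussPi n) (h ∘ e)) :=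
    densMeasure_comp_measurableEquiv hes hh.1
  obtain ⟨S, hS, hSc⟩ := exists_transport n (h ∘ e) hk hkent
  have hT : MeasurePreserving (fun x => e (S (e.symm x))) (densMeasure (gauss n) h) (gauss n) :=
    he.comp (hS.comp hd)
  have hmom := integrable_mul_norm_sq hh hent
  have hX2 : Integrable (fun x => ‖x‖ ^ 2) (densMeasure (gauss n) h) :=
    (integrable_densMeasure_iff hh.1 hh.2.1 _).2 hmom
  have hT2 : Integrable (fun x => ‖e (S (e.symm x))‖ ^ 2) (densMeasure (gauss n) h) :=
    hT.integrable_comp_of_integrable (g := fun x => ‖x‖ ^ 2) integrable_norm_sq_gauss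
  have hT2' : ∫ x, ‖e (S (e.symm x))‖ ^ 2 ∂densMeasure (gauss n) h = n := by
    have := integral_map (μ := densMeasure (gauss n) h) hT.measurable.aemeasurable
      (f := fun y : EuclideanSpace ℝ (Fin n) => ‖y‖ ^ 2) (by fun_prop)
    rw [hT.map_eq, integral_norm_sq_gauss] at this
    exact this.symm
  have hin : Integrable (fun x => inner ℝ x (e (S (e.symm x)))) (densMeasure (gauss n) h) := by
    refine (hX2.add hT2).mono' (continuous_inner.measurable.comp
      (measurable_id.prodMk hT.measurable)).aestronglyMeasurable (.of_forall fun x => ?_)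
    refine (norm_inner_le_norm _ _).trans ?_
    simp only [Pi.add_apply]
    nlinarith [sq_nonneg (‖x‖ - ‖e (S (e.symm x))‖), sq_nonneg ‖x‖, sq_nonneg ‖e (S (e.symm x))‖]
  have b := hSc c hc
  rw [hkeq, ← hd.integral_comp e.symm.measurableEmbedding,
    ← hd.integral_comp e.symm.measurableEmbedding] at b
  have b1 : ∫ x, ∑ i, e.symm x i ^ 2 ∂densMeasure (gauss n) h = ∫ x, h x * ‖x‖ ^ 2 ∂gauss n := by
    rw [← integral_densMeasure hh.1 hh.2.1]
    simp_rw [EuclideanSpace.real_norm_sq_eq]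
    rfl
  have b2 : ∫ x, ∑ i, e.symm x i * S (e.symm x) i ∂densMeasure (gauss n) h =
      ∫ x, inner ℝ x (e (S (e.symm x))) ∂densMeasure (gauss n) h := by
    refine integral_congr_ae (.of_forall fun x => ?_)
    simp only [PiLp.inner_apply]
    refine Finset.sum_congr rfl fun i _ => ?_
    exact mul_comm _ _
  rw [b1, b2] at b
  refine (EReal.coe_ennreal_le_coe_ennreal_iff.2
    (W2_sq_le_of_isCoupling (isCoupling_map hT))).trans ?_
  rw [lintegral_map (by fun_prop) (measurable_id'.prodMk hT.measurable)]
  simp_rw [edist_sq_div_two]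
  -- Both square terms have known integrals, so a lower bound for the correlation is an upper bound
  -- for the cost.
  have ex : ∀ x : EuclideanSpace ℝ (Fin n), ‖x - e (S (e.symm x))‖ ^ 2 / 2 =
      ‖x‖ ^ 2 / 2 + ‖e (S (e.symm x))‖ ^ 2 / 2 - inner ℝ x (e (S (e.symm x))) := fun x => by
    rw [norm_sub_sq_real]; ring
  have j1 : Integrable (fun x => ‖x‖ ^ 2 / 2 + ‖e (S (e.symm x))‖ ^ 2 / 2)
    (densMeasure (gauss n) h) := (hX2.div_const 2).add (hT2.div_const 2)
  rw [← ofReal_integral_eq_lintegral_ofReal ((j1.sub hin).congr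
    (.of_forall fun x => (ex x).symm)) (.of_forall fun x => by positivity)]
  rw [EReal.coe_ennreal_ofReal, EReal.coe_le_coe_iff,
    max_eq_left (integral_nonneg fun x => by positivity)]
  simp_rw [ex]
  rw [integral_sub j1 hin, integral_add (hX2.div_const 2) (hT2.div_const 2), integral_div,
    integral_div, hT2', integral_densMeasure hh.1 hh.2.1]
  linarith

/-- At c = 1 the second moments and the dimensional constants cancel, and only the entropy remains.
-/
theorem classicalTalagrand : ClassicalTalagrand n := by
  intro h hh
  unfold Ent
  split_ifs with hent
  · refine (W2_sq_le_entropy hh hent one_pos).trans (EReal.coe_le_coe_iff.2 ?_)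
    rw [hh.2.2, Real.log_one]
    linarith
  · exact le_top

/-! ### Gaussian integration by parts -/

lemma integrable_gaussLine_iff {f : ℝ → ℝ} :
    Integrable f gaussLine ↔ Integrable (fun t => gaussianPDFReal 0 1 t * f t) := by
  rw [gaussLine, gaussianReal_of_var_ne_zero 0 one_ne_zero,
    integrable_withDensity_iff (measurable_gaussianPDF 0 1) (by simp [gaussianPDF])]
  simp [toReal_gaussianPDF, mul_comm]

/-- Stein's identity. -/
lemma integral_deriv_gaussLine {v : ℝ → ℝ} (hv : Differentiable ℝ v) (h0 : Integrable v gaussLine)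
    (h1 : Integrable (fun t => t * v t) gaussLine) (h2 : Integrable (deriv v) gaussLine) :
    ∫ t, deriv v t ∂gaussLine = ∫ t, t * v t ∂gaussLine := by
  rw [integrable_gaussLine_iff] at h0 h1 h2
  rw [gaussLine, integral_gaussianReal_eq_integral_smul one_ne_zero,
    integral_gaussianReal_eq_integral_smul one_ne_zero]
  have := integral_mul_deriv_eq_deriv_mul_of_integrable (u := gaussianPDFReal 0 1) (v := v)
    (fun x _ => hasDerivAt_gaussianPDFReal x) (fun x _ => (hv x).hasDerivAt) h2
    (by refine h1.neg.congr (.of_forall fun t => ?_); simp; ring) h0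
  simp only [smul_eq_mul]
  rw [this, ← integral_neg]
  congr 1
  ext t
  ring

lemma toLp_insertNth (i : Fin (n + 1)) (t : ℝ) (x : Fin n → ℝ) :
    (WithLp.toLp 2 (i.insertNth t x : Fin (n + 1) → ℝ) : EuclideanSpace ℝ (Fin (n + 1))) =
      WithLp.toLp 2 (i.insertNth 0 x : Fin (n + 1) → ℝ) + t • EuclideanSpace.single i 1 := by
  ext j
  rcases Fin.eq_self_or_eq_succAbove i j with rfl | ⟨k, rfl⟩
  · simp
  · simp

/-- Fubini with the i-th coordinate innermost, so that Stein's identity can be applied along lines.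
-/
lemma integral_gauss_insertNth {F : EuclideanSpace ℝ (Fin (n + 1)) → ℝ}
    (hF : Integrable F (gauss (n + 1))) (i : Fin (n + 1)) :
    (∀ᵐ x ∂gaussPi n, Integrable (fun t => F (WithLp.toLp 2 (i.insertNth t x))) gaussLine) ∧
    ∫ y, F y ∂gauss (n + 1) =
      ∫ x, ∫ t, F (WithLp.toLp 2 (i.insertNth t x)) ∂gaussLine ∂gaussPi n := by
  let e : (Fin (n + 1) → ℝ) ≃ᵐ ℝ × (Fin n → ℝ) := MeasurableEquiv.piFinSuccAbove (fun _ => ℝ) i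
  have he : MeasurePreserving e (gaussPi (n + 1)) (gaussLine.prod (gaussPi n)) :=
    measurePreserving_piFinSuccAbove (fun _ => gaussLine) i
  let e' := MeasurableEquiv.toLp 2 (Fin (n + 1) → ℝ)
  have hp : MeasurePreserving (e.symm.trans e') (gaussLine.prod (gaussPi n)) (gauss (n + 1)) :=
    measurePreserving_toLp.comp (he.symm e)
  have hI : Integrable (F ∘ e.symm.trans e') (gaussLine.prod (gaussPi n)) :=
    (hp.integrable_comp_emb (e.symm.trans e').measurableEmbedding).2 hF
  refine ⟨hI.prod_left_ae, ?_⟩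
  rw [← hp.integral_comp (e.symm.trans e').measurableEmbedding]
  exact integral_prod_symm _ hI

/-- Gaussian integration by parts for compactly supported functions. -/
lemma integral_fderiv_single_gauss {u : EuclideanSpace ℝ (Fin n) → ℝ} (hu : ContDiff ℝ 1 u)
    (hc : HasCompactSupport u) (i : Fin n) :
    ∫ x, fderiv ℝ u x (EuclideanSpace.single i 1) ∂gauss n = ∫ x, x i * u x ∂gauss n := by
  cases n with
  | zero => exact i.elim0
  | succ n =>
    have hu' : Continuous fun x => fderiv ℝ u x (EuclideanSpace.single i 1) :=
      (hu.continuous_fderiv one_ne_zero).clm_apply continuous_const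
    have i0 : Integrable u (gauss (n + 1)) := hu.continuous.integrable_of_hasCompactSupport hc
    have i1 : Integrable (fun x => fderiv ℝ u x (EuclideanSpace.single i 1)) (gauss (n + 1)) :=
      hu'.integrable_of_hasCompactSupport (hc.fderiv_apply (𝕜 := ℝ) _)
    have i2 : Integrable (fun x => x i * u x) (gauss (n + 1)) := by
      refine Continuous.integrable_of_hasCompactSupport ?_ hc.mul_left
      exact (EuclideanSpace.proj (𝕜 := ℝ) i).continuous.mul hu.continuous
    obtain ⟨a0, -⟩ := integral_gauss_insertNth i0 i
    obtain ⟨a1, b1⟩ := integral_gauss_insertNth i1 i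
    obtain ⟨a2, b2⟩ := integral_gauss_insertNth i2 i
    rw [b1, b2]
    refine integral_congr_ae ?_
    filter_upwards [a0, a1, a2] with x hx0 hx1 hx2
    have hd : ∀ t, HasDerivAt (fun t => u (WithLp.toLp 2 (i.insertNth t x)))
        (fderiv ℝ u (WithLp.toLp 2 (i.insertNth t x)) (EuclideanSpace.single i 1)) t := by
      intro t
      have h1 : HasDerivAt (fun t : ℝ => (WithLp.toLp 2 (i.insertNth t x : Fin (n + 1) → ℝ) :
          EuclideanSpace ℝ (Fin (n + 1)))) (EuclideanSpace.single i 1) t := by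
        rw [funext fun t => toLp_insertNth i t x]
        simpa using ((hasDerivAt_id t).smul_const
          (EuclideanSpace.single i (1 : ℝ))).const_add (WithLp.toLp 2 (i.insertNth 0 x : Fin (n + 1) → ℝ))
      exact ((hu.differentiable one_ne_zero _).hasFDerivAt).comp_hasDerivAt t h1
    have key := integral_deriv_gaussLine (v := fun t => u (WithLp.toLp 2 (i.insertNth t x)))
      (fun t => (hd t).differentiableAt) hx0 (by simpa using hx2)
      (by simpa only [funext fun t => (hd t).deriv] using hx1)
    simp only [fun t => (hd t).deriv] at key
    simpa using key

/-! ### Cut-off functions -/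

/-- Monotonicity is essential: it makes η - 2η' nonnegative, as required when the second moment is
obtained by Fatou's lemma. -/
lemma exists_smooth_step : ∃ (θ : ℝ → ℝ) (C : ℝ), ContDiff ℝ 3 θ ∧ (∀ s, 0 ≤ θ s) ∧
    (∀ s, θ s ≤ 1) ∧ (∀ s < 1, θ s = 1) ∧ (∀ s > 2, θ s = 0) ∧ (∀ s, deriv θ s ≤ 0) ∧
    (∀ s, |deriv θ s| ≤ C) ∧ (∀ s, |deriv (deriv θ) s| ≤ C) ∧ 0 ≤ C := by
  let θ : ℝ → ℝ := fun s => Real.smoothTransition (2 - s)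
  have hθ : ContDiff ℝ 3 θ := Real.smoothTransition.contDiff.comp (contDiff_const.sub contDiff_id)
  have h1 : ∀ s < 1, θ s = 1 := fun s hs =>
    Real.smoothTransition.one_of_one_le (by linarith)
  have h2 : ∀ s > 2, θ s = 0 := fun s hs =>
    Real.smoothTransition.zero_of_nonpos (by linarith)
  have d1 : ∀ s < 1, deriv θ s = 0 := fun s hs => by
    have : θ =ᶠ[𝓝 s] fun _ => 1 := by filter_upwards [Iio_mem_nhds hs] with y hy using h1 y hy
    rw [this.deriv_eq, deriv_const]
  have d2 : ∀ s > 2, deriv θ s = 0 := fun s hs => by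
    have : θ =ᶠ[𝓝 s] fun _ => 0 := by filter_upwards [Ioi_mem_nhds hs] with y hy using h2 y hy
    rw [this.deriv_eq, deriv_const]
  have e1 : ∀ s < 1, deriv (deriv θ) s = 0 := fun s hs => by
    have : deriv θ =ᶠ[𝓝 s] fun _ => 0 := by
      filter_upwards [Iio_mem_nhds hs] with y hy using d1 y hy
    rw [this.deriv_eq, deriv_const]
  have e2 : ∀ s > 2, deriv (deriv θ) s = 0 := fun s hs => by
    have : deriv θ =ᶠ[𝓝 s] fun _ => 0 := by
      filter_upwards [Ioi_mem_nhds hs] with y hy using d2 y hy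
    rw [this.deriv_eq, deriv_const]
  have c1 : ContDiff ℝ 2 (deriv θ) := (contDiff_succ_iff_deriv (n := 2)).1 hθ |>.2.2
  have c2 : ContDiff ℝ 1 (deriv (deriv θ)) := (contDiff_succ_iff_deriv (n := 1)).1 c1 |>.2.2
  obtain ⟨C1, hC1⟩ := isCompact_Icc.exists_bound_of_continuousOn (s := Icc (1 : ℝ) 2)
    c1.continuous.continuousOn
  obtain ⟨C2, hC2⟩ := isCompact_Icc.exists_bound_of_continuousOn (s := Icc (1 : ℝ) 2)
    c2.continuous.continuousOn
  have hbd : ∀ (g : ℝ → ℝ) (K : ℝ), (∀ s < 1, g s = 0) → (∀ s > 2, g s = 0) →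
      (∀ s ∈ Icc (1 : ℝ) 2, ‖g s‖ ≤ K) → ∀ s, |g s| ≤ max K 0 := by
    intro g K g1 g2 gK s
    by_cases hs1 : s < 1
    · simp [g1 s hs1]
    · by_cases hs2 : 2 < s
      · simp [g2 s hs2]
      · exact (gK s ⟨not_lt.1 hs1, not_lt.1 hs2⟩).trans (le_max_left _ _)
  have hanti : Antitone θ := fun a b hab =>
    Real.smoothTransition.monotone (by linarith)
  exact ⟨θ, max (max C1 0) (max C2 0), hθ, fun s => Real.smoothTransition.nonneg _,
    fun s => Real.smoothTransition.le_one _, h1, h2, fun s => hanti.deriv_nonpos,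
    fun s => (hbd _ _ d1 d2 hC1 s).trans (le_max_left _ _),
    fun s => (hbd _ _ e1 e2 hC2 s).trans (le_max_right _ _),
    (le_max_right _ _).trans (le_max_left _ _)⟩

/-- Cut-off functions of `|x|²` together with the corrected cut-off `ζ = η - 2 η'` that appears
after one integration by parts. -/
lemma exists_cutoff : ∃ (C : ℝ) (η ζ : ℕ → ℝ → ℝ),
    (∀ N, ContDiff ℝ 1 (η N)) ∧ (∀ N, ContDiff ℝ 1 (ζ N)) ∧
    (∀ N s, ζ N s = η N s - 2 * deriv (η N) s) ∧
    (∀ N, ∃ S, ∀ s > S, η N s = 0 ∧ ζ N s = 0) ∧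
    (∀ N s, |η N s| ≤ 1) ∧ (∀ N s, 0 ≤ ζ N s) ∧ (∀ N s, ζ N s ≤ C) ∧
    (∀ N s, 0 ≤ s → |s * deriv (ζ N) s| ≤ C) ∧
    (∀ s, ∀ᶠ N in atTop, η N s = 1 ∧ ζ N s = 1 ∧ deriv (ζ N) s = 0) := by
  obtain ⟨θ, C, hθ, h0, hle, h1, h2, hneg, hb1, hb2, hC⟩ := exists_smooth_step
  have c1 : ContDiff ℝ 2 (deriv θ) := (contDiff_succ_iff_deriv (n := 2)).1 hθ |>.2.2
  let R : ℕ → ℝ := fun N => N + 1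
  have hR : ∀ N, 1 ≤ R N := fun N => by simp [R]
  have hR0 : ∀ N, 0 < R N := fun N => one_pos.trans_le (hR N)
  let η : ℕ → ℝ → ℝ := fun N s => θ (s / R N)
  let ζ : ℕ → ℝ → ℝ := fun N s => θ (s / R N) - 2 * (deriv θ (s / R N) / R N)
  have dη : ∀ N s, HasDerivAt (η N) (deriv θ (s / R N) / R N) s := fun N s => by
    have := ((hθ.differentiable (by norm_num) (s / R N)).hasDerivAt).comp s
      ((hasDerivAt_id s).div_const (R N))
    refine this.congr_deriv ?_
    ring
  have dζ : ∀ N s, HasDerivAt (ζ N)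
      (deriv θ (s / R N) / R N - 2 * (deriv (deriv θ) (s / R N) / R N / R N)) s := fun N s => by
    have := ((c1.differentiable (by norm_num) (s / R N)).hasDerivAt).comp s
      ((hasDerivAt_id s).div_const (R N))
    refine ((dη N s).sub ((this.div_const (R N)).const_mul 2)).congr_deriv ?_
    ring
  have z1 : ∀ s > 2, deriv θ s = 0 := fun s hs => by
    have : θ =ᶠ[𝓝 s] fun _ => 0 := by filter_upwards [Ioi_mem_nhds hs] with y hy using h2 y hy
    rw [this.deriv_eq, deriv_const]
  have z2 : ∀ s > 2, deriv (deriv θ) s = 0 := fun s hs => by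
    have : deriv θ =ᶠ[𝓝 s] fun _ => 0 := by
      filter_upwards [Ioi_mem_nhds hs] with y hy using z1 y hy
    rw [this.deriv_eq, deriv_const]
  have o1 : ∀ s < 1, deriv θ s = 0 := fun s hs => by
    have : θ =ᶠ[𝓝 s] fun _ => 1 := by filter_upwards [Iio_mem_nhds hs] with y hy using h1 y hy
    rw [this.deriv_eq, deriv_const]
  have o2 : ∀ s < 1, deriv (deriv θ) s = 0 := fun s hs => by
    have : deriv θ =ᶠ[𝓝 s] fun _ => 0 := by
      filter_upwards [Iio_mem_nhds hs] with y hy using o1 y hy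
    rw [this.deriv_eq, deriv_const]
  have hdiv : ∀ N a, |a| ≤ C → |a / R N| ≤ C := fun N a ha => by
    rw [abs_div, abs_of_pos (hR0 N)]
    exact (div_le_self (abs_nonneg _) (hR N)).trans ha
  -- On the support s / R ≤ 2, while the remaining factor of s ζ'(s) is at most 3C; this gives 6C.
  -- The upper bound for ζ needs only 1 + 2C.
  refine ⟨1 + 6 * C, η, ζ, fun N => ?_, fun N => ?_, fun N s => ?_, fun N => ⟨2 * R N, fun s hs => ?_⟩,
    fun N s => ?_, fun N s => ?_, fun N s => ?_, fun N s hs => ?_, fun s => ?_⟩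
  · exact (hθ.of_le (by norm_num)).comp (contDiff_id.div_const _)
  · exact ((hθ.of_le (by norm_num)).comp (contDiff_id.div_const _)).sub (contDiff_const.mul
      (((c1.of_le (by norm_num)).comp (contDiff_id.div_const _)).div_const _))
  · rw [(dη N s).deriv]
  · have : s / R N > 2 := by rw [gt_iff_lt, lt_div_iff₀ (hR0 N)]; exact hs
    simp [η, ζ, h2 _ this, z1 _ this]
  · simp only [η]
    rw [abs_of_nonneg (h0 _)]
    exact hle _
  · have : deriv θ (s / R N) / R N ≤ 0 := div_nonpos_of_nonpos_of_nonneg (hneg _) (hR0 N).le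
    have := h0 (s / R N)
    simp only [ζ]
    linarith
  · have h3 := (abs_le.1 (hdiv N _ (hb1 (s / R N)))).1
    have := hle (s / R N)
    simp only [ζ]
    linarith
  · rw [(dζ N s).deriv]
    by_cases hs2 : s / R N > 2
    · rw [z1 _ hs2, z2 _ hs2]
      simp only [zero_div, mul_zero, sub_zero, abs_zero]
      positivity
    · have e : s * (deriv θ (s / R N) / R N - 2 * (deriv (deriv θ) (s / R N) / R N / R N)) =
        s / R N * (deriv θ (s / R N) - 2 * (deriv (deriv θ) (s / R N) / R N)) := by ring
      have hpos : 0 ≤ s / R N := div_nonneg hs (hR0 N).le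
      rw [e, abs_mul, abs_of_nonneg hpos]
      have a1 := abs_le.1 (hb1 (s / R N))
      have a2 := abs_le.1 (hdiv N _ (hb2 (s / R N)))
      have a3 : |deriv θ (s / R N) - 2 * (deriv (deriv θ) (s / R N) / R N)| ≤ 3 * C :=
        abs_le.2 ⟨by linarith, by linarith⟩
      calc s / R N * |deriv θ (s / R N) - 2 * (deriv (deriv θ) (s / R N) / R N)|
          ≤ 2 * (3 * C) := mul_le_mul (not_lt.1 hs2) a3 (abs_nonneg _) two_pos.le
        _ ≤ 1 + 6 * C := by linarith
  · have : Tendsto R atTop atTop := tendsto_atTop_add_const_right _ _ tendsto_natCast_atTop_atTop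
    filter_upwards [this.eventually_gt_atTop s] with N hN
    have hlt : s / R N < 1 := (div_lt_one (hR0 N)).2 hN
    refine ⟨h1 _ hlt, ?_, ?_⟩
    · simp [ζ, h1 _ hlt, o1 _ hlt]
    · rw [(dζ N s).deriv, o1 _ hlt, o2 _ hlt]
      simp

/-! ### The integral of the Laplacian -/

lemma hasFDerivAt_comp_norm_sq {η : ℝ → ℝ} (hη : Differentiable ℝ η)
    (x : EuclideanSpace ℝ (Fin n)) :
    HasFDerivAt (fun y : EuclideanSpace ℝ (Fin n) => η (‖y‖ ^ 2))
      (deriv η (‖x‖ ^ 2) • (2 • innerSL ℝ x)) x :=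
  (hη _).hasDerivAt.comp_hasFDerivAt x (hasStrictFDerivAt_norm_sq x).hasFDerivAt

lemma hasCompactSupport_comp_norm_sq {η : ℝ → ℝ} {S : ℝ} (hS : ∀ s > S, η s = 0) :
    HasCompactSupport fun y : EuclideanSpace ℝ (Fin n) => η (‖y‖ ^ 2) := by
  refine HasCompactSupport.intro (isCompact_closedBall 0 (|S| + 1)) fun x hx => hS _ ?_
  simp only [Metric.mem_closedBall, dist_zero_right, not_le] at hx
  nlinarith [le_abs_self S, abs_nonneg S, norm_nonneg x]

lemma sum_mul_single (x : EuclideanSpace ℝ (Fin n))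
    (L : EuclideanSpace ℝ (Fin n) →L[ℝ] ℝ) :
    ∑ i, x i * L (EuclideanSpace.single i 1) = L x := by
  conv_rhs => rw [← (EuclideanSpace.basisFun (Fin n) ℝ).sum_repr x]
  simp [map_sum]

lemma laplacian_eq_sum (f : EuclideanSpace ℝ (Fin n) → ℝ) (x : EuclideanSpace ℝ (Fin n)) :
    Laplacian.laplacian f x = ∑ i, fderiv ℝ (fderiv ℝ f) x (EuclideanSpace.single i 1)
      (EuclideanSpace.single i 1) := by
  rw [InnerProductSpace.laplacian_eq_iteratedFDeriv_orthonormalBasis f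
    (EuclideanSpace.basisFun (Fin n) ℝ)]
  simp [iteratedFDeriv_two_apply]

lemma continuous_laplacian {f : EuclideanSpace ℝ (Fin n) → ℝ} (hf : ContDiff ℝ 2 f) :
    Continuous (Laplacian.laplacian f) := by
  have h1 : ContDiff ℝ 1 (fderiv ℝ f) := hf.fderiv_right (m := 1) (by norm_num)
  have h2 : Continuous (fderiv ℝ (fderiv ℝ f)) := h1.continuous_fderiv one_ne_zero
  rw [funext (laplacian_eq_sum f)]
  exact continuous_finsetSum _ fun i _ =>
    (h2.clm_apply continuous_const).clm_apply continuous_const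

/-- First integration by parts, with a radial cut-off. -/
lemma integral_cutoff_mul_laplacian {η : ℝ → ℝ} (hη : ContDiff ℝ 1 η) {S : ℝ}
    (hS : ∀ s > S, η s = 0) {f : EuclideanSpace ℝ (Fin n) → ℝ} (hf : ContDiff ℝ 2 f) :
    ∫ x, η (‖x‖ ^ 2) * Laplacian.laplacian f x ∂gauss n =
      ∫ x, (η (‖x‖ ^ 2) - 2 * deriv η (‖x‖ ^ 2)) * fderiv ℝ f x x ∂gauss n := by
  have h1 : ContDiff ℝ 1 (fderiv ℝ f) := hf.fderiv_right (m := 1) (by norm_num)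
  have hηc : ContDiff ℝ 1 fun y : EuclideanSpace ℝ (Fin n) => η (‖y‖ ^ 2) :=
    hη.comp (contDiff_norm_sq ℝ)
  have hsupp := hasCompactSupport_comp_norm_sq (n := n) hS
  -- Differentiating the radial cut-off gives 2η' x_i ∂_i f, whose sum over i is 2η' x·∇f. Together
  -- with the Gaussian term η x·∇f it forms the factor η - 2η'.
  let u : Fin n → EuclideanSpace ℝ (Fin n) → ℝ := fun i x =>
    η (‖x‖ ^ 2) * fderiv ℝ f x (EuclideanSpace.single i 1)
  have hu : ∀ i, ContDiff ℝ 1 (u i) := fun i => hηc.mul (h1.clm_apply contDiff_const)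
  have huc : ∀ i, HasCompactSupport (u i) := fun i => hsupp.mul_right
  have hdu : ∀ i x, fderiv ℝ (u i) x (EuclideanSpace.single i 1) =
      η (‖x‖ ^ 2) * fderiv ℝ (fderiv ℝ f) x (EuclideanSpace.single i 1)
        (EuclideanSpace.single i 1) +
      2 * deriv η (‖x‖ ^ 2) * (x i * fderiv ℝ f x (EuclideanSpace.single i 1)) := by
    intro i x
    have a := (hasFDerivAt_comp_norm_sq (hη.differentiable one_ne_zero) x).mul
      (((h1.differentiable one_ne_zero x).hasFDerivAt).clm_apply
        (hasFDerivAt_const (EuclideanSpace.single i (1 : ℝ)) x))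
    have a' : HasFDerivAt (u i) _ x := a
    rw [a'.fderiv]
    simp [EuclideanSpace.inner_single_right]
    ring
  have key : ∑ i, ∫ x, fderiv ℝ (u i) x (EuclideanSpace.single i 1) ∂gauss n =
      ∑ i, ∫ x, x i * u i x ∂gauss n :=
    Finset.sum_congr rfl fun i _ => integral_fderiv_single_gauss (hu i) (huc i) i
  have I1 : ∀ i, Integrable (fun x => fderiv ℝ (u i) x (EuclideanSpace.single i 1)) (gauss n) :=
    fun i => (((hu i).continuous_fderiv one_ne_zero).clm_apply
      continuous_const).integrable_of_hasCompactSupport ((huc i).fderiv_apply (𝕜 := ℝ) _)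
  have I2 : ∀ i, Integrable (fun x => x i * u i x) (gauss n) := fun i =>
    ((EuclideanSpace.proj (𝕜 := ℝ) i).continuous.mul
      (hu i).continuous).integrable_of_hasCompactSupport (huc i).mul_left
  rw [← integral_finsetSum _ fun i _ => I1 i, ← integral_finsetSum _ fun i _ => I2 i] at key
  have s1 : ∀ x, ∑ i, fderiv ℝ (u i) x (EuclideanSpace.single i 1) =
      η (‖x‖ ^ 2) * Laplacian.laplacian f x + 2 * deriv η (‖x‖ ^ 2) * fderiv ℝ f x x := by
    intro x
    simp_rw [hdu]
    rw [Finset.sum_add_distrib, ← Finset.mul_sum, ← Finset.mul_sum, sum_mul_single,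
      laplacian_eq_sum]
  have s2 : ∀ x, ∑ i, x i * u i x = η (‖x‖ ^ 2) * fderiv ℝ f x x := by
    intro x
    rw [← sum_mul_single, Finset.mul_sum]
    refine Finset.sum_congr rfl fun i _ => ?_
    simp only [u]
    ring
  simp_rw [s1, s2] at key
  have J1 : Integrable (fun x => η (‖x‖ ^ 2) * Laplacian.laplacian f x) (gauss n) :=
    (hηc.continuous.mul (continuous_laplacian hf)).integrable_of_hasCompactSupport hsupp.mul_right
  have J2 : Integrable (fun x => 2 * deriv η (‖x‖ ^ 2) * fderiv ℝ f x x) (gauss n) := by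
    have := (integrable_finsetSum Finset.univ fun i _ => I1 i).sub J1
    refine this.congr (.of_forall fun x => ?_)
    simp [s1]
  have J3 : Integrable (fun x => η (‖x‖ ^ 2) * fderiv ℝ f x x) (gauss n) := by
    refine (integrable_finsetSum Finset.univ fun i _ => I2 i).congr (.of_forall fun x => ?_)
    simp [s2]
  rw [integral_add J1 J2] at key
  simp_rw [sub_mul]
  rw [integral_sub J3 J2]
  linarith

/-- Second integration by parts, with a radial cut-off. -/
lemma integral_cutoff_mul_fderiv {ζ : ℝ → ℝ} (hζ : ContDiff ℝ 1 ζ) {S : ℝ}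
    (hS : ∀ s > S, ζ s = 0) {f : EuclideanSpace ℝ (Fin n) → ℝ} (hf : ContDiff ℝ 1 f) :
    ∫ x, ζ (‖x‖ ^ 2) * fderiv ℝ f x x ∂gauss n =
      ∫ x, ((‖x‖ ^ 2 - n) * ζ (‖x‖ ^ 2) - 2 * (‖x‖ ^ 2 * deriv ζ (‖x‖ ^ 2))) * f x ∂gauss n := by
  have hζc : ContDiff ℝ 1 fun y : EuclideanSpace ℝ (Fin n) => ζ (‖y‖ ^ 2) :=
    hζ.comp (contDiff_norm_sq ℝ)
  have hsupp := hasCompactSupport_comp_norm_sq (n := n) hS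
  have hpr : ∀ i : Fin n, ContDiff ℝ 1 fun x : EuclideanSpace ℝ (Fin n) => x i := fun i =>
    (EuclideanSpace.proj (𝕜 := ℝ) i).contDiff
  let u : Fin n → EuclideanSpace ℝ (Fin n) → ℝ := fun i x => ζ (‖x‖ ^ 2) * (x i * f x)
  have hu : ∀ i, ContDiff ℝ 1 (u i) := fun i => hζc.mul ((hpr i).mul hf)
  have huc : ∀ i, HasCompactSupport (u i) := fun i => hsupp.mul_right
  have hdu : ∀ i x, fderiv ℝ (u i) x (EuclideanSpace.single i 1) =
      ζ (‖x‖ ^ 2) * (x i * fderiv ℝ f x (EuclideanSpace.single i 1)) + ζ (‖x‖ ^ 2) * f x +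
      2 * deriv ζ (‖x‖ ^ 2) * f x * x i ^ 2 := by
    intro i x
    have a := (hasFDerivAt_comp_norm_sq (hζ.differentiable one_ne_zero) x).mul
      (((EuclideanSpace.proj (𝕜 := ℝ) i).hasFDerivAt (x := x)).mul
        (hf.differentiable one_ne_zero x).hasFDerivAt)
    have a' : HasFDerivAt (u i) _ x := a
    rw [a'.fderiv]
    simp [EuclideanSpace.inner_single_right]
    ring
  have key : ∑ i, ∫ x, fderiv ℝ (u i) x (EuclideanSpace.single i 1) ∂gauss n =
      ∑ i, ∫ x, x i * u i x ∂gauss n :=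
    Finset.sum_congr rfl fun i _ => integral_fderiv_single_gauss (hu i) (huc i) i
  have I1 : ∀ i, Integrable (fun x => fderiv ℝ (u i) x (EuclideanSpace.single i 1)) (gauss n) :=
    fun i => (((hu i).continuous_fderiv one_ne_zero).clm_apply
      continuous_const).integrable_of_hasCompactSupport ((huc i).fderiv_apply (𝕜 := ℝ) _)
  have I2 : ∀ i, Integrable (fun x => x i * u i x) (gauss n) := fun i =>
    ((EuclideanSpace.proj (𝕜 := ℝ) i).continuous.mul
      (hu i).continuous).integrable_of_hasCompactSupport (huc i).mul_left
  rw [← integral_finsetSum _ fun i _ => I1 i, ← integral_finsetSum _ fun i _ => I2 i] at key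
  have s1 : ∀ x, ∑ i, fderiv ℝ (u i) x (EuclideanSpace.single i 1) =
      ζ (‖x‖ ^ 2) * fderiv ℝ f x x + (n * ζ (‖x‖ ^ 2) +
        2 * (‖x‖ ^ 2 * deriv ζ (‖x‖ ^ 2))) * f x := by
    intro x
    simp_rw [hdu]
    rw [Finset.sum_add_distrib, Finset.sum_add_distrib, ← Finset.mul_sum, ← Finset.mul_sum,
      ← Finset.mul_sum, sum_mul_single, ← EuclideanSpace.real_norm_sq_eq x, Finset.sum_const, Finset.card_univ,
      Fintype.card_fin, nsmul_eq_mul]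
    ring
  have s2 : ∀ x, ∑ i, x i * u i x = ‖x‖ ^ 2 * ζ (‖x‖ ^ 2) * f x := by
    intro x
    rw [EuclideanSpace.real_norm_sq_eq x, Finset.sum_mul, Finset.sum_mul]
    refine Finset.sum_congr rfl fun i _ => ?_
    simp only [u, EuclideanSpace.real_norm_sq_eq x]
    ring
  simp_rw [s1, s2] at key
  have hid : Continuous fun x => fderiv ℝ f x x :=
    (hf.continuous_fderiv one_ne_zero).clm_apply continuous_id
  have J1 : Integrable (fun x => ζ (‖x‖ ^ 2) * fderiv ℝ f x x) (gauss n) :=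
    (hζc.continuous.mul hid).integrable_of_hasCompactSupport hsupp.mul_right
  have J2 : Integrable (fun x => (n * ζ (‖x‖ ^ 2) +
        2 * (‖x‖ ^ 2 * deriv ζ (‖x‖ ^ 2))) * f x) (gauss n) := by
    have := (integrable_finsetSum Finset.univ fun i _ => I1 i).sub J1
    refine this.congr (.of_forall fun x => ?_)
    simp [s1]
  have J3 : Integrable (fun x => ‖x‖ ^ 2 * ζ (‖x‖ ^ 2) * f x) (gauss n) := by
    refine (integrable_finsetSum Finset.univ fun i _ => I2 i).congr (.of_forall fun x => ?_)
    simp [s2]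
  rw [integral_add J1 J2] at key
  have e : ∀ x : EuclideanSpace ℝ (Fin n),
      ((‖x‖ ^ 2 - n) * ζ (‖x‖ ^ 2) - 2 * (‖x‖ ^ 2 * deriv ζ (‖x‖ ^ 2))) * f x =
      ‖x‖ ^ 2 * ζ (‖x‖ ^ 2) * f x - (n * ζ (‖x‖ ^ 2) +
        2 * (‖x‖ ^ 2 * deriv ζ (‖x‖ ^ 2))) * f x := fun x => by ring
  simp_rw [e]
  rw [integral_sub J3 J2]
  linarith

lemma tendsto_integral_cutoff {η : ℕ → ℝ → ℝ} (hη : ∀ N, ContDiff ℝ 1 (η N)) {C : ℝ}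
    (hb : ∀ N s, |η N s| ≤ C) (h1 : ∀ s, ∀ᶠ N in atTop, η N s = 1)
    {g : EuclideanSpace ℝ (Fin n) → ℝ} (hg : Integrable g (gauss n)) :
    Tendsto (fun N => ∫ x, η N (‖x‖ ^ 2) * g x ∂gauss n) atTop (𝓝 (∫ x, g x ∂gauss n)) := by
  refine tendsto_integral_of_dominated_convergence (fun x => C * ‖g x‖) (fun N => ?_)
    (hg.norm.const_mul C) (fun N => .of_forall fun x => ?_) (.of_forall fun x => ?_)
  · exact (((hη N).continuous.comp (continuous_norm.pow 2)).aestronglyMeasurable).mul hg.1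
  · rw [norm_mul]
    exact mul_le_mul_of_nonneg_right (hb N _) (norm_nonneg _)
  · refine tendsto_const_nhds.congr' ?_
    filter_upwards [h1 (‖x‖ ^ 2)] with N hN
    rw [hN, one_mul]

/-- One integration by parts, with the cut-offs removed by dominated convergence; it supplies the
cross term of the energy in the refined Poincaré inequality. -/
lemma integral_laplacian_eq_integral_fderiv {f : EuclideanSpace ℝ (Fin n) → ℝ}
    (hf : ContDiff ℝ 2 f) (hL : Integrable (Laplacian.laplacian f) (gauss n))
    (hD : Integrable (fun x => fderiv ℝ f x x) (gauss n)) :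
    ∫ x, Laplacian.laplacian f x ∂gauss n = ∫ x, fderiv ℝ f x x ∂gauss n := by
  obtain ⟨C, η, ζ, cη, cζ, hζ, hS, bη, pζ, bζ, -, hev⟩ := exists_cutoff
  have t1 := tendsto_integral_cutoff cη bη (fun s => (hev s).mono fun N h => h.1) hL
  have t2 := tendsto_integral_cutoff cζ (fun N s => (abs_of_nonneg (pζ N s)).trans_le (bζ N s))
    (fun s => (hev s).mono fun N h => h.2.1) hD
  refine tendsto_nhds_unique t1 (t2.congr fun N => ?_)
  obtain ⟨S, hS⟩ := hS N
  rw [integral_cutoff_mul_laplacian (cη N) (fun s hs => (hS s hs).1) hf]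
  simp_rw [hζ]

lemma integral_cutoff_laplacian_eq {η ζ : ℝ → ℝ} (cη : ContDiff ℝ 1 η) (cζ : ContDiff ℝ 1 ζ)
    (hζ : ∀ s, ζ s = η s - 2 * deriv η s) {S : ℝ} (hS : ∀ s > S, η s = 0 ∧ ζ s = 0)
    {f : EuclideanSpace ℝ (Fin n) → ℝ} (hf : ContDiff ℝ 2 f) :
    ∫ x, η (‖x‖ ^ 2) * Laplacian.laplacian f x ∂gauss n =
      ∫ x, ((‖x‖ ^ 2 - n) * ζ (‖x‖ ^ 2) - 2 * (‖x‖ ^ 2 * deriv ζ (‖x‖ ^ 2))) * f x ∂gauss n := by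
  rw [integral_cutoff_mul_laplacian cη (fun s hs => (hS s hs).1) hf,
    ← integral_cutoff_mul_fderiv cζ (fun s hs => (hS s hs).2) (hf.of_le (by norm_num))]
  simp_rw [hζ]

/-- The Laplacian is moved onto the Gaussian weight, and Δφ = (|x|² - n)φ. The bound on s ζ'(s) lets
|f|(1 + |x|²), up to constants, dominate the error terms. -/
lemma integral_laplacian_eq {f : EuclideanSpace ℝ (Fin n) → ℝ}
    (hf : ContDiff ℝ 2 f) (hL : Integrable (Laplacian.laplacian f) (gauss n))
    (h0 : Integrable f (gauss n)) (h2 : Integrable (fun x => f x * ‖x‖ ^ 2) (gauss n)) :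
    ∫ x, Laplacian.laplacian f x ∂gauss n =
      (∫ x, f x * ‖x‖ ^ 2 ∂gauss n) - n * ∫ x, f x ∂gauss n := by
  obtain ⟨C, η, ζ, cη, cζ, hζ, hS, bη, pζ, bζ, bd, hev⟩ := exists_cutoff
  have t1 := tendsto_integral_cutoff cη bη (fun s => (hev s).mono fun N h => h.1) hL
  have habs : ∀ N s, |ζ N s| ≤ C := fun N s => (abs_of_nonneg (pζ N s)).trans_le (bζ N s)
  have t2 : Tendsto (fun N => ∫ x, ((‖x‖ ^ 2 - n) * ζ N (‖x‖ ^ 2) -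
      2 * (‖x‖ ^ 2 * deriv (ζ N) (‖x‖ ^ 2))) * f x ∂gauss n) atTop
      (𝓝 (∫ x, (‖x‖ ^ 2 - n) * f x ∂gauss n)) := by
    refine tendsto_integral_of_dominated_convergence
      (fun x => C * ‖f x * ‖x‖ ^ 2‖ + (n * C + 2 * C) * ‖f x‖) (fun N => ?_)
      ((h2.norm.const_mul C).add (h0.norm.const_mul _)) (fun N => .of_forall fun x => ?_)
      (.of_forall fun x => ?_)
    · have c1 := (cζ N).continuous
      have c2 := (cζ N).continuous_deriv_one
      have : Continuous f := hf.continuous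
      exact Continuous.aestronglyMeasurable (by fun_prop)
    · have a1 := habs N (‖x‖ ^ 2)
      have a2 := bd N (‖x‖ ^ 2) (by positivity)
      rw [norm_mul, norm_mul (f x), Real.norm_eq_abs, Real.norm_eq_abs, Real.norm_eq_abs,
        abs_of_nonneg (by positivity : 0 ≤ ‖x‖ ^ 2)]
      have a3 : |(‖x‖ ^ 2 - n) * ζ N (‖x‖ ^ 2) - 2 * (‖x‖ ^ 2 * deriv (ζ N) (‖x‖ ^ 2))| ≤
          (‖x‖ ^ 2 + n) * C + 2 * C := by
        refine (abs_sub _ _).trans ?_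
        rw [abs_mul, abs_mul]
        have : |‖x‖ ^ 2 - (n : ℝ)| ≤ ‖x‖ ^ 2 + n := by
          refine (abs_sub _ _).trans ?_
          rw [abs_of_nonneg (by positivity : 0 ≤ ‖x‖ ^ 2), abs_of_nonneg (by positivity : (0 : ℝ) ≤ n)]
        have h3 := mul_le_mul this a1 (abs_nonneg _) (by positivity)
        simp only [abs_two]
        linarith
      have := mul_le_mul_of_nonneg_right a3 (abs_nonneg (f x))
      linarith
    · refine tendsto_const_nhds.congr' ?_
      filter_upwards [hev (‖x‖ ^ 2)] with N hN
      rw [hN.2.1, hN.2.2]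
      ring
  have e : ∫ x, (‖x‖ ^ 2 - n) * f x ∂gauss n =
      (∫ x, f x * ‖x‖ ^ 2 ∂gauss n) - n * ∫ x, f x ∂gauss n := by
    rw [← integral_const_mul, ← integral_sub h2 (h0.const_mul _)]
    congr 1
    ext x
    ring
  rw [← e]
  refine tendsto_nhds_unique t1 (t2.congr fun N => ?_)
  obtain ⟨S, hS⟩ := hS N
  exact (integral_cutoff_laplacian_eq (cη N) (cζ N) (hζ N) hS hf).symm

/-- A nonnegative integrable function with an integrable Laplacian has a second moment. -/
lemma integrable_mul_norm_sq_of_laplacian {h : EuclideanSpace ℝ (Fin n) → ℝ}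
    (hh : ContDiff ℝ 2 h) (hpos : ∀ x, 0 ≤ h x) (h0 : Integrable h (gauss n))
    (hL : Integrable (Laplacian.laplacian h) (gauss n)) :
    Integrable (fun x => h x * ‖x‖ ^ 2) (gauss n) := by
  obtain ⟨C, η, ζ, cη, cζ, hζ, hS, bη, pζ, bζ, bd, hev⟩ := exists_cutoff
  have hc : Continuous h := hh.continuous
  have habs : ∀ N s, |ζ N s| ≤ C := fun N s => (abs_of_nonneg (pζ N s)).trans_le (bζ N s)
  have m0 : Continuous fun x => h x * ‖x‖ ^ 2 := by fun_prop
  have mN : ∀ N, Continuous fun x => h x * ‖x‖ ^ 2 * ζ N (‖x‖ ^ 2) := fun N => by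
    have := (cζ N).continuous
    fun_prop
  have iN : ∀ N, Integrable (fun x => h x * ‖x‖ ^ 2 * ζ N (‖x‖ ^ 2)) (gauss n) := fun N => by
    obtain ⟨S, hS⟩ := hS N
    exact (mN N).integrable_of_hasCompactSupport
      (hasCompactSupport_comp_norm_sq (n := n) fun s hs => (hS s hs).2).mul_left
  -- The cut-off identity is solved for the truncated second moment; all its other terms are bounded
  -- uniformly in N. Fatou's lemma then removes the cut-off.
  have bN : ∀ N, ∫ x, h x * ‖x‖ ^ 2 * ζ N (‖x‖ ^ 2) ∂gauss n ≤
      (∫ x, |Laplacian.laplacian h x| ∂gauss n) + (n * C + 2 * C) * ∫ x, h x ∂gauss n := by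
    intro N
    obtain ⟨S, hS⟩ := hS N
    have k1 := integral_cutoff_laplacian_eq (cη N) (cζ N) (hζ N) hS hh
    have c1 := (cζ N).continuous
    have c2 := (cζ N).continuous_deriv_one
    have c3 := (cη N).continuous
    have j : Integrable (fun x => (n * ζ N (‖x‖ ^ 2) +
        2 * (‖x‖ ^ 2 * deriv (ζ N) (‖x‖ ^ 2))) * h x) (gauss n) := by
      refine (h0.const_mul (n * C + 2 * C)).mono' (Continuous.aestronglyMeasurable (by fun_prop))
        (.of_forall fun x => ?_)
      rw [norm_mul, Real.norm_of_nonneg (hpos x)]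
      refine mul_le_mul_of_nonneg_right ?_ (hpos x)
      refine (norm_add_le _ _).trans ?_
      rw [norm_mul, norm_mul, Real.norm_eq_abs, Real.norm_eq_abs, Real.norm_eq_abs,
        Real.norm_eq_abs, Nat.abs_cast, abs_two]
      have := mul_le_mul_of_nonneg_left (habs N (‖x‖ ^ 2)) (Nat.cast_nonneg (α := ℝ) n)
      have := bd N (‖x‖ ^ 2) (by positivity)
      linarith
    have e : ∀ x : EuclideanSpace ℝ (Fin n),
        ((‖x‖ ^ 2 - n) * ζ N (‖x‖ ^ 2) - 2 * (‖x‖ ^ 2 * deriv (ζ N) (‖x‖ ^ 2))) * h x =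
        h x * ‖x‖ ^ 2 * ζ N (‖x‖ ^ 2) - (n * ζ N (‖x‖ ^ 2) +
        2 * (‖x‖ ^ 2 * deriv (ζ N) (‖x‖ ^ 2))) * h x := fun x => by ring
    simp_rw [e] at k1
    rw [integral_sub (iN N) j] at k1
    have k2 : ∫ x, η N (‖x‖ ^ 2) * Laplacian.laplacian h x ∂gauss n ≤
        ∫ x, |Laplacian.laplacian h x| ∂gauss n := by
      have hb : ∀ x : EuclideanSpace ℝ (Fin n), |η N (‖x‖ ^ 2) * Laplacian.laplacian h x| ≤
          |Laplacian.laplacian h x| := fun x => by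
        rw [abs_mul]
        exact mul_le_of_le_one_left (abs_nonneg _) (bη N _)
      exact integral_mono (hL.bdd_mul (c := 1) (Continuous.aestronglyMeasurable (by fun_prop))
        (.of_forall fun x => bη N _)) hL.abs fun x => (le_abs_self _).trans (hb x)
    have k3 : ∫ x, (n * ζ N (‖x‖ ^ 2) +
        2 * (‖x‖ ^ 2 * deriv (ζ N) (‖x‖ ^ 2))) * h x ∂gauss n ≤
        (n * C + 2 * C) * ∫ x, h x ∂gauss n := by
      rw [← integral_const_mul]
      refine integral_mono j (h0.const_mul _) fun x => mul_le_mul_of_nonneg_right ?_ (hpos x)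
      have := mul_le_mul_of_nonneg_left (bζ N (‖x‖ ^ 2)) (Nat.cast_nonneg (α := ℝ) n)
      have := (abs_le.1 (bd N (‖x‖ ^ 2) (by positivity))).2
      linarith
    linarith
  refine ⟨m0.aestronglyMeasurable, ?_⟩
  rw [hasFiniteIntegral_iff_ofReal (.of_forall fun x => mul_nonneg (hpos x) (by positivity))]
  have hF : ∫⁻ x, ENNReal.ofReal (h x * ‖x‖ ^ 2) ∂gauss n ≤
      liminf (fun N => ∫⁻ x, ENNReal.ofReal (h x * ‖x‖ ^ 2 * ζ N (‖x‖ ^ 2)) ∂gauss n) atTop := by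
    refine le_trans (le_of_eq ?_) (lintegral_liminf_le fun N => (mN N).measurable.ennreal_ofReal)
    refine lintegral_congr fun x => ?_
    refine (Tendsto.liminf_eq (tendsto_const_nhds.congr' ?_)).symm
    filter_upwards [hev (‖x‖ ^ 2)] with N hN
    rw [hN.2.1, mul_one]
  refine hF.trans_lt (lt_of_le_of_lt (liminf_le_of_frequently_le' (Eventually.frequently
    (Eventually.of_forall fun N => ?_))) (ENNReal.ofReal_lt_top
    (r := (∫ x, |Laplacian.laplacian h x| ∂gauss n) + (n * C + 2 * C) * ∫ x, h x ∂gauss n)))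
  rw [← ofReal_integral_eq_lintegral_ofReal (iN N) (.of_forall fun x =>
    mul_nonneg (mul_nonneg (hpos x) (by positivity)) (pζ N _))]
  exact ENNReal.ofReal_le_ofReal (bN N)

theorem refinedTalagrand (hn : 1 ≤ n) : RefinedTalagrand n := by
  intro h hh hC hL
  have hn0 : (0 : ℝ) < n := by exact_mod_cast hn
  have hmom := integrable_mul_norm_sq_of_laplacian hC hh.2.1 hh.integrable hL
  have hM := integral_laplacian_eq hC hL hh.integrable hmom
  rw [hh.2.2, mul_one] at hM
  rw [hM]
  set A := ∫ x, h x * ‖x‖ ^ 2 ∂gauss n with hA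
  unfold Ent
  split_ifs with hent
  · rw [hh.2.2, Real.log_one, mul_zero, sub_zero]
    set E := ∫ x, h x * Real.log (h x) ∂gauss n with hE
    -- This c maximises c (n(1/2 - log c) + A/2 - E). At the maximum the bracket equals n, so the
    -- bound becomes A/2 + n/2 - nc.
    have key := W2_sq_le_entropy hh hent (Real.exp_pos (1 / (2 * n) * (A - n) - 1 / n * E))
    refine key.trans (le_of_eq ?_)
    rw [← hA, ← hE, Real.log_exp, ← EReal.coe_mul, ← EReal.coe_sub, EReal.exp_coe,
      EReal.coe_ennreal_ofReal, max_eq_left (Real.exp_pos _).le, ← EReal.coe_one,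
      ← EReal.coe_sub, ← EReal.coe_natCast, ← EReal.coe_mul, ← EReal.coe_add, EReal.coe_eq_coe_iff]
    have e : n * (1 / 2 - (1 / (2 * n) * (A - n) - 1 / n * E)) + 1 / 2 * A - E = n := by
      field_simp
      ring
    rw [e]
    ring
  -- With infinite entropy the exponential is zero, and the right-hand side A/2 + n/2 is the cost of
  -- the independent coupling.
  · have hpos : (0 : ℝ) < 1 / n := by positivity
    rw [EReal.coe_mul_top_of_pos hpos, EReal.sub_top, EReal.exp_bot, EReal.coe_ennreal_zero,
      sub_zero, mul_one, ← EReal.coe_natCast, ← EReal.coe_add]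
    have hA0 : 0 ≤ A := integral_nonneg fun x => mul_nonneg (hh.2.1 x) (by positivity)
    refine (EReal.coe_ennreal_le_coe_ennreal_iff.2 (W2_sq_le_add hh hmom)).trans ?_
    rw [EReal.coe_ennreal_ofReal, EReal.coe_le_coe_iff, ← hA, max_eq_left (by positivity)]
    linarith

/-! ### The Gaussian Poincaré inequality on the line -/

lemma enorm_sq_eq_ofReal (a : ℝ) : ‖a‖ₑ ^ 2 = ENNReal.ofReal (a ^ 2) := by
  rw [Real.enorm_eq_ofReal_abs, ← ENNReal.ofReal_pow (abs_nonneg a), sq_abs]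

/-- Cauchy–Schwarz, obtained by expanding the integral of (f' - l)² ≥ 0 with l the mean slope on [0,
t]. -/
lemma sq_sub_le_mul_integral {f : ℝ → ℝ} (hf : ContDiff ℝ 1 f) {t : ℝ} (ht : 0 < t) :
    (f t - f 0) ^ 2 ≤ t * ∫ s in (0 : ℝ)..t, deriv f s ^ 2 := by
  have hc : Continuous (deriv f) := hf.continuous_deriv_one
  have h1 : ∫ s in (0 : ℝ)..t, deriv f s = f t - f 0 :=
    intervalIntegral.integral_deriv_eq_sub (fun x _ => hf.differentiable one_ne_zero x)
      (hc.intervalIntegrable _ _)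
  set l := (f t - f 0) / t with hl
  have h2 : 0 ≤ ∫ s in (0 : ℝ)..t, (deriv f s - l) ^ 2 :=
    intervalIntegral.integral_nonneg ht.le fun s _ => sq_nonneg _
  have h3 : ∫ s in (0 : ℝ)..t, (deriv f s - l) ^ 2 =
      (∫ s in (0 : ℝ)..t, deriv f s ^ 2) - 2 * l * (f t - f 0) + t * l ^ 2 := by
    have e : ∀ s, (deriv f s - l) ^ 2 = deriv f s ^ 2 - 2 * l * deriv f s + l ^ 2 := fun s => by
      ring
    simp_rw [e]
    rw [intervalIntegral.integral_add (Continuous.intervalIntegrable (by fun_prop) _ _)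
      (Continuous.intervalIntegrable (by fun_prop) _ _),
      intervalIntegral.integral_sub (Continuous.intervalIntegrable (by fun_prop) _ _)
      (Continuous.intervalIntegrable (by fun_prop) _ _), intervalIntegral.integral_const_mul, h1]
    simp
  have h4 : f t - f 0 = t * l := by rw [hl]; field_simp
  rw [h3, h4] at h2
  rw [h4]
  nlinarith

lemma setLIntegral_Ici_gaussLine {s : ℝ} (hs : 0 < s) :
    ∫⁻ t in Ici s, ENNReal.ofReal t ∂gaussLine = ENNReal.ofReal (gaussianPDFReal 0 1 s) := by
  rw [← setIntegral_Ioi_gaussLine, ← setLIntegral_congr Ioi_ae_eq_Ici,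
    ofReal_integral_eq_lintegral_ofReal]
  · exact ((memLp_id_gaussianReal' 1 (by simp)).integrable le_rfl).integrableOn
  · exact (ae_restrict_mem measurableSet_Ioi).mono fun t ht => (hs.trans ht).le

/-- After Cauchy–Schwarz and Tonelli, the weight of f'(s)² is ∫_s^∞ tφ(t) dt = φ(s). The Gaussian
density is reproduced, hence the constant 1. -/
lemma setLIntegral_Ioi_sq_sub_le {f : ℝ → ℝ} (hf : ContDiff ℝ 1 f) :
    ∫⁻ t in Ioi 0, ‖f t - f 0‖ₑ ^ 2 ∂gaussLine ≤ ∫⁻ t in Ioi 0, ‖deriv f t‖ₑ ^ 2 ∂gaussLine := by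
  have hc : Continuous (deriv f) := hf.continuous_deriv_one
  simp_rw [enorm_sq_eq_ofReal]
  let K : ℝ × ℝ → ℝ≥0∞ := {p : ℝ × ℝ | 0 < p.2 ∧ p.2 ≤ p.1}.indicator
    fun p => ENNReal.ofReal p.1 * ENNReal.ofReal (deriv f p.2 ^ 2)
  have hKm : Measurable K := by
    refine Measurable.indicator (by fun_prop) ?_
    exact (measurableSet_lt measurable_const measurable_snd).inter
      (measurableSet_le measurable_snd measurable_fst)
  have b1 : ∀ t ∈ Ioi (0 : ℝ), ENNReal.ofReal ((f t - f 0) ^ 2) ≤ ∫⁻ s, K (t, s) := by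
    intro t ht
    refine (ENNReal.ofReal_le_ofReal (sq_sub_le_mul_integral hf ht)).trans (le_of_eq ?_)
    rw [ENNReal.ofReal_mul (le_of_lt ht), intervalIntegral.integral_of_le (le_of_lt ht),
      ofReal_integral_eq_lintegral_ofReal (by exact (hc.pow 2).integrableOn_Ioc)
        (.of_forall fun s => sq_nonneg _), ← lintegral_indicator measurableSet_Ioc,
      ← lintegral_const_mul' _ _ ENNReal.ofReal_ne_top]
    refine lintegral_congr fun s => ?_
    by_cases hs : 0 < s ∧ s ≤ t
    · simp [K, hs.1, hs.2]
    · simp only [K]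
      rw [indicator_of_notMem (by exact hs), indicator_of_notMem (by exact hs), mul_zero]
  have b2 : ∀ s, ∫⁻ t, K (t, s) ∂gaussLine = (Ioi (0 : ℝ)).indicator (fun s =>
      gaussianPDF 0 1 s * ENNReal.ofReal (deriv f s ^ 2)) s := by
    intro s
    by_cases hs : 0 < s
    · have : ∀ t, K (t, s) = (Ici s).indicator ENNReal.ofReal t * ENNReal.ofReal (deriv f s ^ 2) := by
        intro t
        by_cases hst : s ≤ t <;> simp [K, hs, hst]
      simp_rw [this]
      rw [lintegral_mul_const' _ _ ENNReal.ofReal_ne_top, lintegral_indicator measurableSet_Ici,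
        setLIntegral_Ici_gaussLine hs, indicator_of_mem (by exact hs)]
      rfl
    · have : ∀ t, K (t, s) = 0 := fun t => indicator_of_notMem (fun h => hs h.1) _
      simp [this, hs]
  calc ∫⁻ t in Ioi 0, ENNReal.ofReal ((f t - f 0) ^ 2) ∂gaussLine
      ≤ ∫⁻ t in Ioi 0, (∫⁻ s, K (t, s)) ∂gaussLine :=
        setLIntegral_mono' measurableSet_Ioi b1
    _ ≤ ∫⁻ t, (∫⁻ s, K (t, s)) ∂gaussLine := setLIntegral_le_lintegral _ _
    _ = ∫⁻ s, ∫⁻ t, K (t, s) ∂gaussLine := lintegral_lintegral_swap (f := fun t s => K (t, s)) hKm.aemeasurable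
    _ = ∫⁻ t in Ioi 0, ENNReal.ofReal (deriv f t ^ 2) ∂gaussLine := by
        simp_rw [b2]
        rw [gaussLine, gaussianReal_of_var_ne_zero 0 one_ne_zero,
          lintegral_indicator measurableSet_Ioi,
          setLIntegral_withDensity_eq_setLIntegral_mul _ (measurable_gaussianPDF 0 1)
            (by fun_prop) measurableSet_Ioi]
        rfl

/-- The negative half-line follows by reflection, which preserves γ. Centring at f(0) instead of the
mean is harmless, since the mean minimises the quadratic deviation. -/
lemma lintegral_sq_sub_le {f : ℝ → ℝ} (hf : ContDiff ℝ 1 f) :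
    ∫⁻ t, ‖f t - f 0‖ₑ ^ 2 ∂gaussLine ≤ ∫⁻ t, ‖deriv f t‖ₑ ^ 2 ∂gaussLine := by
  have hsplit : ∀ g : ℝ → ℝ≥0∞, ∫⁻ t, g t ∂gaussLine =
      ∫⁻ t in Ioi 0, g t ∂gaussLine + ∫⁻ t in Ioi 0, g (-t) ∂gaussLine := by
    intro g
    have hneg : MeasurePreserving (MeasurableEquiv.neg ℝ) gaussLine gaussLine :=
      ⟨(MeasurableEquiv.neg ℝ).measurable, by
        have := gaussianReal_map_neg (μ := 0) (v := 1)
        rw [neg_zero] at this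
        exact this⟩
    have h1 := hneg.setLIntegral_comp_preimage_emb (MeasurableEquiv.neg ℝ).measurableEmbedding g
      (Iio 0)
    have h2 : (MeasurableEquiv.neg ℝ) ⁻¹' (Iio 0) = Ioi 0 := by
      ext t; simp
    rw [h2] at h1
    have h3 : ∫⁻ t in Ioi 0, g (-t) ∂gaussLine = ∫⁻ t in Iic 0, g t ∂gaussLine := by
      rw [← setLIntegral_congr Iio_ae_eq_Iic]
      exact h1
    rw [h3, ← compl_Iic, add_comm]
    exact (lintegral_add_compl g measurableSet_Iic).symm
  rw [hsplit, hsplit]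
  have h1 := setLIntegral_Ioi_sq_sub_le hf
  have h2 := setLIntegral_Ioi_sq_sub_le (f := fun t => f (-t)) (hf.comp contDiff_neg)
  simp only [neg_zero] at h2
  refine add_le_add h1 (h2.trans (le_of_eq ?_))
  refine lintegral_congr fun t => ?_
  rw [deriv_comp_neg, enorm_neg]

/-! ### Tensorization of the variance -/

lemma evariance_le_lintegral_sub {Ω : Type*} [MeasurableSpace Ω] {μ : Measure Ω}
    [IsProbabilityMeasure μ] {f : Ω → ℝ} (hf : MemLp f 2 μ) (c : ℝ) :
    evariance f μ ≤ ∫⁻ x, ‖f x - c‖ₑ ^ 2 ∂μ := by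
  have hfc : MemLp (fun x => f x - c) 2 μ := hf.sub (memLp_const c)
  simp_rw [enorm_sq_eq_ofReal]
  rw [← hf.ofReal_variance_eq, ← ofReal_integral_eq_lintegral_ofReal hfc.integrable_sq
    (.of_forall fun x => sq_nonneg _)]
  refine ENNReal.ofReal_le_ofReal ?_
  rw [← variance_sub_const hf.1 c]
  exact variance_le_expectation_sq hfc.1

lemma memLp_two_of_bound {Ω : Type*} [MeasurableSpace Ω] {μ : Measure Ω} [IsProbabilityMeasure μ]
    {g : Ω → ℝ} {C : ℝ} (hg : Measurable g) (hC : ∀ x, |g x| ≤ C) : MemLp g 2 μ :=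
  MemLp.of_bound hg.aestronglyMeasurable _ (.of_forall hC)

lemma abs_integral_le_of_bound {Ω : Type*} [MeasurableSpace Ω] {μ : Measure Ω}
    [IsProbabilityMeasure μ] {g : Ω → ℝ} {C : ℝ} (hC : ∀ x, |g x| ≤ C) : |∫ x, g x ∂μ| ≤ C := by
  have := norm_integral_le_of_norm_le_const (μ := μ) (f := g) (.of_forall hC)
  simpa using this

section Tensorization

variable {A B : Type*} [MeasurableSpace A] [MeasurableSpace B] {α : Measure A} {β : Measure B}
  [IsProbabilityMeasure α] [IsProbabilityMeasure β]

/-- The variance of a mean is at most the mean of the variances. -/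
lemma variance_integral_le {f : A × B → ℝ} (hf : Measurable f) {K : ℝ} (hK : ∀ p, |f p| ≤ K) :
    variance (fun a => ∫ b, f (a, b) ∂β) α ≤ ∫ b, variance (fun a => f (a, b)) α ∂β := by
  have hfa : ∀ a, Measurable fun b => f (a, b) := fun a => hf.comp (by fun_prop)
  have hfb : ∀ b, Measurable fun a => f (a, b) := fun b => hf.comp (by fun_prop)
  have hI : Integrable f (α.prod β) := (memLp_two_of_bound hf hK).integrable one_le_two
  have hpm : Measurable fun a => ∫ b, f (a, b) ∂β :=
    (hf.stronglyMeasurable.integral_prod_right' (ν := β)).measurable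
  have hqm : Measurable fun b => ∫ a, f (a, b) ∂α :=
    (hf.stronglyMeasurable.integral_prod_left' (μ := α)).measurable
  have hqb : ∀ b, |∫ a, f (a, b) ∂α| ≤ K := fun b => abs_integral_le_of_bound fun a => hK _
  -- Once the fibre means are subtracted, the claim is (∫ g db)² ≤ ∫ g² db, integrated over a.
  let g : A × B → ℝ := fun p => f p - ∫ a, f (a, p.2) ∂α
  have hgm : Measurable g := hf.sub (hqm.comp measurable_snd)
  have hgb : ∀ p, |g p| ≤ K + K := fun p => (abs_sub _ _).trans (add_le_add (hK p) (hqb p.2))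
  have hg2 : Integrable (fun p => g p ^ 2) (α.prod β) :=
    (memLp_two_of_bound hgm hgb).integrable_sq
  have e1 : ∀ b, variance (fun a => f (a, b)) α = ∫ a, g (a, b) ^ 2 ∂α := fun b =>
    variance_eq_integral (hfb b).aemeasurable
  simp_rw [e1]
  rw [variance_eq_integral hpm.aemeasurable, ← integral_integral_swap (f := fun a b => g (a, b) ^ 2) hg2]
  refine integral_mono ?_ hg2.integral_prod_left fun a => ?_
  · exact ((memLp_two_of_bound hpm (C := K) fun a => abs_integral_le_of_bound fun b =>
      hK _).sub (memLp_const _)).integrable_sq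
  · have hga : Measurable fun b => g (a, b) := hgm.comp (by fun_prop)
    have e2 : (∫ b, f (a, b) ∂β) - ∫ a, ∫ b, f (a, b) ∂β ∂α = ∫ b, g (a, b) ∂β := by
      simp only [g]
      rw [integral_sub ((memLp_two_of_bound (hfa a) fun b => hK _).integrable one_le_two)
        ((memLp_two_of_bound hqm hqb).integrable one_le_two),
        integral_integral_swap (f := fun a b => f (a, b)) hI]
    simp only
    rw [e2]
    have h1 := variance_nonneg (fun b => g (a, b)) β
    rw [variance_eq_sub (memLp_two_of_bound hga fun b => hgb _)] at h1
    simpa using h1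

/-- The law of total variance, in which `variance_integral_le` bounds the variance of the
conditional mean. -/
lemma variance_prod_le {f : A × B → ℝ} (hf : Measurable f) {K : ℝ} (hK : ∀ p, |f p| ≤ K) :
    variance f (α.prod β) ≤ (∫ b, variance (fun a => f (a, b)) α ∂β) +
      ∫ a, variance (fun b => f (a, b)) β ∂α := by
  have hfa : ∀ a, Measurable fun b => f (a, b) := fun a => hf.comp (by fun_prop)
  have hF : MemLp f 2 (α.prod β) := memLp_two_of_bound hf hK
  have hpm : Measurable fun a => ∫ b, f (a, b) ∂β :=
    (hf.stronglyMeasurable.integral_prod_right' (ν := β)).measurable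
  have hp : MemLp (fun a => ∫ b, f (a, b) ∂β) 2 α :=
    memLp_two_of_bound hpm (C := K) fun a => abs_integral_le_of_bound fun b => hK _
  refine le_trans (le_of_eq ?_) (add_le_add_left (variance_integral_le hf hK) _)
  have e1 : ∀ a, variance (fun b => f (a, b)) β =
      (∫ b, f (a, b) ^ 2 ∂β) - (∫ b, f (a, b) ∂β) ^ 2 := fun a => by
    rw [variance_eq_sub (memLp_two_of_bound (hfa a) fun b => hK _)]
    simp
  simp_rw [e1]
  rw [variance_eq_sub hF, variance_eq_sub hp, integral_sub hF.integrable_sq.integral_prod_left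
    hp.integrable_sq]
  simp only [Pi.pow_apply]
  rw [integral_prod _ hF.integrable_sq, integral_prod _ (hF.integrable one_le_two)]
  ring

lemma measurable_variance_left {f : A × B → ℝ} (hf : Measurable f) {K : ℝ}
    (hK : ∀ p, |f p| ≤ K) : Measurable fun b => variance (fun a => f (a, b)) α := by
  have e : ∀ b, variance (fun a => f (a, b)) α =
      (∫ a, f (a, b) ^ 2 ∂α) - (∫ a, f (a, b) ∂α) ^ 2 := fun b => by
    have hb : Measurable fun a => f (a, b) := hf.comp (by fun_prop)
    rw [variance_eq_sub (memLp_two_of_bound hb fun a => hK _)]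
    simp
  simp_rw [e]
  exact ((hf.pow_const 2).stronglyMeasurable.integral_prod_left' (μ := α)).measurable.sub
    ((hf.stronglyMeasurable.integral_prod_left' (μ := α)).measurable.pow_const 2)

lemma variance_le_sq_of_bound {Ω : Type*} [MeasurableSpace Ω] {μ : Measure Ω}
    [IsProbabilityMeasure μ] {g : Ω → ℝ} {C : ℝ} (hg : Measurable g) (hC : ∀ x, |g x| ≤ C) :
    variance g μ ≤ C ^ 2 := by
  refine (variance_le_expectation_sq hg.aestronglyMeasurable).trans ?_
  have := abs_integral_le_of_bound (μ := μ) (g := fun x => g x ^ 2) (C := C ^ 2) fun x => by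
    rw [abs_pow]
    exact pow_le_pow_left₀ (abs_nonneg _) (hC x) 2
  exact (le_abs_self _).trans this

/-- Subadditivity of the variance on a product space. -/
lemma evariance_prod_le {f : A × B → ℝ} (hf : Measurable f) {K : ℝ} (hK : ∀ p, |f p| ≤ K) :
    evariance f (α.prod β) ≤ (∫⁻ b, evariance (fun a => f (a, b)) α ∂β) +
      ∫⁻ a, evariance (fun b => f (a, b)) β ∂α := by
  have hfa : ∀ a, Measurable fun b => f (a, b) := fun a => hf.comp (by fun_prop)
  have hfb : ∀ b, Measurable fun a => f (a, b) := fun b => hf.comp (by fun_prop)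
  simp_rw [← fun a => (memLp_two_of_bound (μ := β) (hfa a) fun b => hK _).ofReal_variance_eq,
    ← fun b => (memLp_two_of_bound (μ := α) (hfb b) fun a => hK _).ofReal_variance_eq,
    ← (memLp_two_of_bound (μ := α.prod β) hf hK).ofReal_variance_eq]
  have m1 : Measurable fun b => variance (fun a => f (a, b)) α := measurable_variance_left hf hK
  have m2 : Measurable fun a => variance (fun b => f (a, b)) β :=
    measurable_variance_left (f := f ∘ Prod.swap) (hf.comp measurable_swap) fun p => hK _
  rw [← ofReal_integral_eq_lintegral_ofReal _ (.of_forall fun b => variance_nonneg _ _),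
    ← ofReal_integral_eq_lintegral_ofReal _ (.of_forall fun b => variance_nonneg _ _),
    ← ENNReal.ofReal_add (integral_nonneg fun b => variance_nonneg _ _)
      (integral_nonneg fun b => variance_nonneg _ _)]
  · exact ENNReal.ofReal_le_ofReal (variance_prod_le hf hK)
  · refine Integrable.of_bound m2.aestronglyMeasurable (K ^ 2) (.of_forall fun a => ?_)
    rw [Real.norm_of_nonneg (variance_nonneg _ _)]
    exact variance_le_sq_of_bound (hfa a) fun b => hK _
  · refine Integrable.of_bound m1.aestronglyMeasurable (K ^ 2) (.of_forall fun b => ?_)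
    rw [Real.norm_of_nonneg (variance_nonneg _ _)]
    exact variance_le_sq_of_bound (hfb b) fun a => hK _

end Tensorization

/-! ### The Gaussian Poincaré inequality -/

/-- The embedding of `Fin n → ℝ` as the last `n` coordinates. -/
def succEmb (n : ℕ) : (Fin n → ℝ) →L[ℝ] (Fin (n + 1) → ℝ) :=
  ContinuousLinearMap.pi (Fin.cases 0 fun i => ContinuousLinearMap.proj i)

lemma succEmb_single {n : ℕ} (i : Fin n) :
    succEmb n (Pi.single i 1) = Pi.single i.succ 1 := by
  ext j
  refine Fin.cases ?_ (fun j => ?_) j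
  · simp [succEmb]
  · by_cases h : j = i
    · subst h; simp [succEmb]
    · simp [succEmb, h]

/-- Tensorization splits off the first coordinate, where the one-dimensional inequality applies;
induction treats the rest. Boundedness keeps every partial variance finite. -/
theorem evariance_le_of_bound (n : ℕ) {f : (Fin n → ℝ) → ℝ} (hf : ContDiff ℝ 1 f) {K : ℝ}
    (hK : ∀ x, |f x| ≤ K) :
    evariance f (gaussPi n) ≤ ∑ i, ∫⁻ x, ‖fderiv ℝ f x (Pi.single i 1)‖ₑ ^ 2 ∂gaussPi n := by
  induction n with
  | zero =>
    refine (evariance_le_lintegral_sub (memLp_two_of_bound hf.continuous.measurable hK)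
      (f 0)).trans (le_of_eq ?_)
    have h0 : ∀ x : Fin 0 → ℝ, f x - f 0 = 0 := fun x => by rw [Subsingleton.elim x 0, sub_self]
    simp_rw [h0]
    simp
  | succ n ih =>
    let e : (Fin (n + 1) → ℝ) ≃ᵐ ℝ × (Fin n → ℝ) := MeasurableEquiv.piFinSuccAbove (fun _ => ℝ) 0
    have he : MeasurePreserving e (gaussPi (n + 1)) (gaussLine.prod (gaussPi n)) :=
      measurePreserving_piFinSuccAbove (fun _ => gaussLine) 0
    have hes : MeasurePreserving e.symm (gaussLine.prod (gaussPi n)) (gaussPi (n + 1)) :=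
      he.symm e
    have hsum : ∀ t x, e.symm (t, x) = t • Pi.single 0 1 + succEmb n x := by
      intro t x
      have h0 : e.symm (t, x) 0 = t := by
        have : (e (e.symm (t, x))).1 = e.symm (t, x) 0 := rfl
        rw [← this, e.apply_symm_apply]
      have h1 : ∀ i : Fin n, e.symm (t, x) i.succ = x i := fun i => by
        have : (e (e.symm (t, x))).2 i = e.symm (t, x) i.succ := rfl
        rw [← this, e.apply_symm_apply]
      ext j
      refine Fin.cases ?_ (fun j => ?_) j
      · rw [h0]; simp [succEmb]
      · rw [h1]; simp [succEmb]
    have hfm := hf.continuous.measurable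
    have hvar : evariance f (gaussPi (n + 1)) =
        evariance (f ∘ e.symm) (gaussLine.prod (gaussPi n)) := by
      unfold evariance
      have h1 : ∫ x, f x ∂gaussPi (n + 1) = ∫ x, (f ∘ e.symm) x ∂gaussLine.prod (gaussPi n) :=
        (hes.integral_comp e.symm.measurableEmbedding f).symm
      rw [h1, ← hes.lintegral_comp_emb e.symm.measurableEmbedding]
      rfl
    have hdm : ∀ v, Measurable fun x => ‖fderiv ℝ f x v‖ₑ ^ 2 := fun v =>
      (((hf.continuous_fderiv one_ne_zero).clm_apply continuous_const).measurable).enorm.pow_const 2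
    have hint : ∀ v, ∫⁻ x, ‖fderiv ℝ f x v‖ₑ ^ 2 ∂gaussPi (n + 1) =
        ∫⁻ p, ‖fderiv ℝ f (e.symm p) v‖ₑ ^ 2 ∂gaussLine.prod (gaussPi n) := fun v =>
      (hes.lintegral_comp_emb e.symm.measurableEmbedding _).symm
    rw [hvar, Fin.sum_univ_succ]
    refine (evariance_prod_le (hfm.comp e.symm.measurable) fun p => hK _).trans
      (add_le_add ?_ ?_)
    · rw [hint, lintegral_prod_symm _ (by exact ((hdm _).comp e.symm.measurable).aemeasurable)]
      refine lintegral_mono fun x => ?_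
      have hd : ∀ t, HasDerivAt (fun t => f (e.symm (t, x)))
          (fderiv ℝ f (e.symm (t, x)) (Pi.single 0 1)) t := by
        intro t
        have h1 : HasDerivAt (fun t => e.symm (t, x)) (Pi.single 0 1) t := by
          rw [funext fun t => hsum t x]
          simpa using ((hasDerivAt_id t).smul_const
            (Pi.single 0 1 : Fin (n + 1) → ℝ)).add_const (succEmb n x)
        exact ((hf.differentiable one_ne_zero _).hasFDerivAt).comp_hasDerivAt t h1
      have hcd : ContDiff ℝ 1 fun t => f (e.symm (t, x)) := by
        simp_rw [hsum]
        exact hf.comp ((contDiff_id.smul contDiff_const).add contDiff_const)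
      refine (evariance_le_lintegral_sub (memLp_two_of_bound hcd.continuous.measurable
        fun t => hK _) (f (e.symm (0, x)))).trans ((lintegral_sq_sub_le hcd).trans (le_of_eq ?_))
      simp_rw [(hd _).deriv]
    · simp_rw [hint]
      rw [← lintegral_finsetSum _ fun i _ => by exact (hdm _).comp e.symm.measurable,
        lintegral_prod _ (by exact (Finset.measurable_sum _ fun i _ =>
          (hdm _).comp e.symm.measurable).aemeasurable)]
      refine lintegral_mono fun t => ?_
      have hd : ∀ x i, fderiv ℝ (fun x => f (e.symm (t, x))) x (Pi.single i 1) =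
          fderiv ℝ f (e.symm (t, x)) (Pi.single i.succ 1) := by
        intro x i
        have h1 : HasFDerivAt (fun x => e.symm (t, x)) (succEmb n) x := by
          rw [funext fun x => hsum t x]
          exact (succEmb n).hasFDerivAt.const_add _
        have h2 : HasFDerivAt (fun x => f (e.symm (t, x))) _ x :=
          ((hf.differentiable one_ne_zero (e.symm (t, x))).hasFDerivAt).comp x h1
        rw [h2.fderiv, ContinuousLinearMap.comp_apply, succEmb_single]
      have hcd : ContDiff ℝ 1 fun x => f (e.symm (t, x)) := by
        simp_rw [hsum]
        exact hf.comp (contDiff_const.add (succEmb n).contDiff)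
      refine (ih hcd fun x => hK _).trans (le_of_eq ?_)
      simp_rw [hd]
      exact (lintegral_finsetSum _ fun i _ => (hdm _).comp
        (e.symm.measurable.comp measurable_prodMk_left)).symm

/-! ### Removing the boundedness assumption. -/

/-- The doubled form contains no mean, so Fatou's lemma can be applied to truncations before f is
known to be integrable. -/
lemma lintegral_lintegral_sub_sq {Ω : Type*} [MeasurableSpace Ω] {μ : Measure Ω}
    [IsProbabilityMeasure μ] {f : Ω → ℝ} (hf : MemLp f 2 μ) :
    ∫⁻ y, ∫⁻ x, ‖f x - f y‖ₑ ^ 2 ∂μ ∂μ = 2 * evariance f μ := by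
  have h1 := hf.integrable one_le_two
  have h2 := hf.integrable_sq
  have e : ∀ x y, (f x - f y) ^ 2 = f x ^ 2 - 2 * f y * f x + f y ^ 2 := fun x y => by ring
  have hy : ∀ y, ∫⁻ x, ‖f x - f y‖ₑ ^ 2 ∂μ = ENNReal.ofReal
      ((∫ x, f x ^ 2 ∂μ) - 2 * f y * (∫ x, f x ∂μ) + f y ^ 2) := by
    intro y
    have hfy : MemLp (fun x => f x - f y) 2 μ := hf.sub (memLp_const _)
    have i1 : Integrable (fun x => f x ^ 2 - 2 * f y * f x) μ := h2.sub (h1.const_mul _)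
    simp_rw [enorm_sq_eq_ofReal]
    rw [← ofReal_integral_eq_lintegral_ofReal hfy.integrable_sq (.of_forall fun x => sq_nonneg _)]
    simp_rw [e]
    rw [integral_add i1 (integrable_const _), integral_sub h2 (h1.const_mul _),
      integral_const_mul]
    simp
  have i2 : Integrable (fun y => (∫ x, f x ^ 2 ∂μ) - 2 * f y * (∫ x, f x ∂μ)) μ :=
    (integrable_const _).sub ((h1.const_mul 2).mul_const _)
  have i3 : Integrable (fun y => (∫ x, f x ^ 2 ∂μ) - 2 * f y * (∫ x, f x ∂μ) + f y ^ 2) μ :=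
    i2.add h2
  have hvar := variance_eq_sub hf
  simp only [Pi.pow_apply] at hvar
  simp_rw [hy]
  rw [← ofReal_integral_eq_lintegral_ofReal i3 (.of_forall fun y => ?_), integral_add i2 h2,
    integral_sub (integrable_const _) ((h1.const_mul 2).mul_const _), integral_mul_const,
    integral_const_mul, ← hf.ofReal_variance_eq, hvar,
    ← ENNReal.ofReal_ofNat 2, ← ENNReal.ofReal_mul two_pos.le]
  · congr 1
    simp
    ring
  · have h3 := variance_nonneg f μ
    rw [hvar] at h3
    simp only [Pi.zero_apply]
    nlinarith [sq_nonneg (f y - ∫ x, f x ∂μ)]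

/-- A bounded approximation of the identity with derivative at most one. -/
def arctanTrunc (N : ℕ) (u : ℝ) : ℝ := (N + 1) * Real.arctan (u / (N + 1))

lemma hasDerivAt_arctanTrunc (N : ℕ) (u : ℝ) :
    HasDerivAt (arctanTrunc N) (1 / (1 + (u / (N + 1)) ^ 2)) u := by
  have hN : (N + 1 : ℝ) ≠ 0 := by positivity
  have := (((hasDerivAt_id u).div_const (N + 1 : ℝ)).arctan).const_mul (N + 1 : ℝ)
  refine this.congr_deriv ?_
  simp only [id]
  field_simp

lemma contDiff_arctanTrunc (N : ℕ) : ContDiff ℝ 1 (arctanTrunc N) :=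
  contDiff_const.mul (Real.contDiff_arctan.comp (contDiff_id.div_const _))

lemma abs_arctanTrunc_le (N : ℕ) (u : ℝ) : |arctanTrunc N u| ≤ (N + 1) * (Real.pi / 2) := by
  rw [arctanTrunc, abs_mul, abs_of_nonneg (by positivity : (0 : ℝ) ≤ N + 1)]
  refine mul_le_mul_of_nonneg_left (abs_le.2 ⟨?_, ?_⟩) (by positivity)
  · exact (Real.neg_pi_div_two_lt_arctan _).le
  · exact (Real.arctan_lt_pi_div_two _).le

lemma tendsto_arctanTrunc (u : ℝ) : Tendsto (fun N => arctanTrunc N u) atTop (𝓝 u) := by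
  have h1 : HasDerivAt (fun s : ℝ => Real.arctan (s * u)) u 0 := by
    have := ((hasDerivAt_id (0 : ℝ)).mul_const u).arctan
    simpa using this
  have h2 : Tendsto (fun N : ℕ => 1 / ((N : ℝ) + 1)) atTop (𝓝[≠] 0) :=
    tendsto_nhdsWithin_iff.2 ⟨tendsto_one_div_add_atTop_nhds_zero_nat,
      .of_forall fun N => (by positivity : 1 / ((N : ℝ) + 1) ≠ 0)⟩
  refine (h1.tendsto_slope_zero.comp h2).congr fun N => ?_
  simp [arctanTrunc, div_eq_inv_mul]

/-- The Gaussian Poincaré inequality, including square integrability. -/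
theorem memLp_and_evariance_le {f : (Fin n → ℝ) → ℝ} (hf : ContDiff ℝ 1 f)
    (hD : ∑ i, ∫⁻ x, ‖fderiv ℝ f x (Pi.single i 1)‖ₑ ^ 2 ∂gaussPi n ≠ ∞) :
    MemLp f 2 (gaussPi n) ∧ evariance f (gaussPi n) ≤
      ∑ i, ∫⁻ x, ‖fderiv ℝ f x (Pi.single i 1)‖ₑ ^ 2 ∂gaussPi n := by
  set D := ∑ i, ∫⁻ x, ‖fderiv ℝ f x (Pi.single i 1)‖ₑ ^ 2 ∂gaussPi n with hDdef
  let g : ℕ → (Fin n → ℝ) → ℝ := fun N x => arctanTrunc N (f x)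
  have hg : ∀ N, ContDiff ℝ 1 (g N) := fun N => (contDiff_arctanTrunc N).comp hf
  have hgb : ∀ N x, |g N x| ≤ (N + 1) * (Real.pi / 2) := fun N x => abs_arctanTrunc_le N _
  have hgv : ∀ N, evariance (g N) (gaussPi n) ≤ D := by
    intro N
    refine (evariance_le_of_bound n (hg N) (hgb N)).trans
      (Finset.sum_le_sum fun i _ => lintegral_mono fun x => ?_)
    have hd := (hasDerivAt_arctanTrunc N (f x)).comp_hasFDerivAt x
      (hf.differentiable one_ne_zero x).hasFDerivAt
    have hd' : HasFDerivAt (g N) _ x := hd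
    rw [hd'.fderiv]
    simp only [smul_apply, smul_eq_mul, enorm_mul]
    gcongr
    refine mul_le_of_le_one_left' ?_
    rw [Real.enorm_eq_ofReal (by positivity)]
    refine ENNReal.ofReal_le_one.2 ?_
    rw [div_le_one (by positivity)]
    nlinarith [sq_nonneg (f x / (N + 1))]
  have hm : ∀ N, Measurable fun p : (Fin n → ℝ) × (Fin n → ℝ) => ‖g N p.1 - g N p.2‖ₑ ^ 2 :=
    fun N => by
      have := (hg N).continuous.measurable
      fun_prop
  have hfm := hf.continuous.measurable
  have hm' : Measurable fun p : (Fin n → ℝ) × (Fin n → ℝ) => ‖f p.1 - f p.2‖ₑ ^ 2 := by fun_prop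
  have hF : ∫⁻ y, ∫⁻ x, ‖f x - f y‖ₑ ^ 2 ∂gaussPi n ∂gaussPi n ≤ 2 * D := by
    rw [← lintegral_prod_symm _ hm'.aemeasurable]
    calc ∫⁻ p, ‖f p.1 - f p.2‖ₑ ^ 2 ∂(gaussPi n).prod (gaussPi n)
        = ∫⁻ p, liminf (fun N => ‖g N p.1 - g N p.2‖ₑ ^ 2) atTop
            ∂(gaussPi n).prod (gaussPi n) := by
          refine lintegral_congr fun p => (Tendsto.liminf_eq ?_).symm
          exact ((ENNReal.continuous_pow 2).tendsto _).comp (((tendsto_arctanTrunc (f p.1)).sub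
            (tendsto_arctanTrunc (f p.2))).enorm)
      _ ≤ liminf (fun N => ∫⁻ p, ‖g N p.1 - g N p.2‖ₑ ^ 2 ∂(gaussPi n).prod (gaussPi n)) atTop :=
          lintegral_liminf_le hm
      _ ≤ 2 * D := by
          refine liminf_le_of_frequently_le' (Eventually.frequently
            (Eventually.of_forall fun N => ?_))
          rw [lintegral_prod_symm _ (hm N).aemeasurable, lintegral_lintegral_sub_sq
            (memLp_two_of_bound (hg N).continuous.measurable (hgb N))]
          gcongr
          exact hgv N
  have hL2 : MemLp f 2 (gaussPi n) := by
    -- A finite double integral gives one y with f - f(y) in L², and constants are in L².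
    have hlt : ∀ᵐ y ∂gaussPi n, ∫⁻ x, ‖f x - f y‖ₑ ^ 2 ∂gaussPi n < ∞ :=
      ae_lt_top (Measurable.lintegral_prod_left' hm')
        (hF.trans_lt (ENNReal.mul_lt_top (by simp) hD.lt_top)).ne
    obtain ⟨y, hy⟩ := hlt.exists
    have h1 : MemLp (fun x => f x - f y) 2 (gaussPi n) := by
      rw [memLp_two_iff_integrable_sq (hfm.sub_const _).aestronglyMeasurable]
      refine ⟨((hfm.sub_const _).pow_const 2).aestronglyMeasurable, ?_⟩
      rw [hasFiniteIntegral_iff_enorm]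
      simpa [enorm_pow] using hy
    have h2 := h1.add (memLp_const (f y))
    rwa [show ((fun x => f x - f y) + fun _ => f y) = f from funext fun x => sub_add_cancel _ _] at h2
  refine ⟨hL2, ?_⟩
  rw [lintegral_lintegral_sub_sq hL2] at hF
  exact (ENNReal.mul_le_mul_iff_right two_ne_zero ENNReal.ofNat_ne_top).1 hF

/-! ### Transfer of the Poincaré inequality to Euclidean space. -/

lemma inner_gradient {f : EuclideanSpace ℝ (Fin n) → ℝ} (x v : EuclideanSpace ℝ (Fin n)) :
    inner ℝ (gradient f x) v = fderiv ℝ f x v := by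
  rw [gradient, InnerProductSpace.toDual_symm_apply]

lemma norm_gradient_sq (f : EuclideanSpace ℝ (Fin n) → ℝ) (x : EuclideanSpace ℝ (Fin n)) :
    ‖gradient f x‖ ^ 2 = ∑ i, fderiv ℝ f x (EuclideanSpace.single i 1) ^ 2 := by
  rw [EuclideanSpace.real_norm_sq_eq]
  refine Finset.sum_congr rfl fun i _ => ?_
  rw [← inner_gradient, EuclideanSpace.inner_single_right]
  simp

lemma enorm_gradient_sq (f : EuclideanSpace ℝ (Fin n) → ℝ) (x : EuclideanSpace ℝ (Fin n)) :
    ‖gradient f x‖ₑ ^ 2 = ∑ i, ‖fderiv ℝ f x (EuclideanSpace.single i 1)‖ₑ ^ 2 := by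
  simp_rw [enorm_sq_eq_ofReal]
  rw [← ENNReal.ofReal_sum_of_nonneg fun i _ => sq_nonneg _, ← norm_gradient_sq,
    ENNReal.ofReal_pow (norm_nonneg _), ofReal_norm]

lemma memLp_and_evariance_le_gauss {f : EuclideanSpace ℝ (Fin n) → ℝ} (hf : ContDiff ℝ 1 f)
    (hD : ∫⁻ x, ‖gradient f x‖ₑ ^ 2 ∂gauss n ≠ ∞) :
    MemLp f 2 (gauss n) ∧ evariance f (gauss n) ≤ ∫⁻ x, ‖gradient f x‖ₑ ^ 2 ∂gauss n := by
  let e := MeasurableEquiv.toLp 2 (Fin n → ℝ)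
  have he : MeasurePreserving e (gaussPi n) (gauss n) := measurePreserving_toLp
  let L : (Fin n → ℝ) ≃L[ℝ] EuclideanSpace ℝ (Fin n) :=
    (PiLp.continuousLinearEquiv 2 ℝ fun _ : Fin n => ℝ).symm
  have hL : ∀ x, L x = e x := fun x => rfl
  have hfd : ∀ x i, fderiv ℝ (f ∘ e) x (Pi.single i 1) =
      fderiv ℝ f (e x) (EuclideanSpace.single i 1) := by
    intro x i
    have h1 : HasFDerivAt (f ∘ e) _ x :=
      ((hf.differentiable one_ne_zero (L x)).hasFDerivAt).comp x L.hasFDerivAt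
    rw [h1.fderiv]
    rfl
  have hcd : ContDiff ℝ 1 (f ∘ e) := hf.comp L.contDiff
  have hdm : ∀ v, Measurable fun x => ‖fderiv ℝ f x v‖ₑ ^ 2 := fun v =>
    (((hf.continuous_fderiv one_ne_zero).clm_apply continuous_const).measurable).enorm.pow_const 2
  have hsum : ∑ i, ∫⁻ x, ‖fderiv ℝ (f ∘ e) x (Pi.single i 1)‖ₑ ^ 2 ∂gaussPi n =
      ∫⁻ x, ‖gradient f x‖ₑ ^ 2 ∂gauss n := by
    simp_rw [hfd, enorm_gradient_sq]
    rw [lintegral_finsetSum _ fun i _ => hdm _]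
    exact Finset.sum_congr rfl fun i _ => he.lintegral_comp (hdm _)
  obtain ⟨h1, h2⟩ := memLp_and_evariance_le hcd (by rwa [hsum])
  rw [hsum] at h2
  refine ⟨h1.comp_measurePreserving (he.symm e), ?_⟩
  refine le_trans (le_of_eq ?_) h2
  unfold evariance
  rw [← he.integral_comp e.measurableEmbedding f, ← he.lintegral_comp_emb e.measurableEmbedding]
  rfl

/-! ### The refined Poincaré inequality -/

lemma memLp_norm_sq_gauss :
    MemLp (fun x : EuclideanSpace ℝ (Fin n) => ‖x‖ ^ 2) 2 (gauss n) := by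
  rw [memLp_two_iff_integrable_sq (by fun_prop)]
  have h := (IsGaussian.memLp_id (gauss n) 4 (by simp)).integrable_norm_pow (p := 4) (by norm_num)
  refine h.congr (.of_forall fun x => ?_)
  simp only [id]
  ring

lemma fderiv_norm_sq_euclidean (x : EuclideanSpace ℝ (Fin n)) :
    fderiv ℝ (fun y : EuclideanSpace ℝ (Fin n) => ‖y‖ ^ 2) x = 2 • innerSL ℝ x :=
  (hasStrictFDerivAt_norm_sq x).hasFDerivAt.fderiv

lemma laplacian_norm_sq (x : EuclideanSpace ℝ (Fin n)) :
    Laplacian.laplacian (fun y : EuclideanSpace ℝ (Fin n) => ‖y‖ ^ 2) x = 2 * n := by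
  rw [laplacian_eq_sum, funext fderiv_norm_sq_euclidean]
  have h : HasFDerivAt (fun y : EuclideanSpace ℝ (Fin n) => 2 • innerSL ℝ y) (2 • innerSL ℝ) x :=
    (innerSL ℝ).hasFDerivAt.const_smul 2
  rw [h.fderiv]
  trans ∑ _i : Fin n, (2 : ℝ)
  · refine Finset.sum_congr rfl fun i _ => ?_
    change (2 : ℕ) • inner ℝ (EuclideanSpace.single i (1 : ℝ)) (EuclideanSpace.single i (1 : ℝ)) = _
    simp
  · simp [mul_comm]

/-- Integration by parts for |x|² itself, whose Laplacian is 2n. It follows that |x|² has variance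
2n. -/
lemma integral_norm_pow_four_gauss :
    ∫ x, ‖x‖ ^ 2 * ‖x‖ ^ 2 ∂gauss n = n ^ 2 + 2 * n := by
  have h := integral_laplacian_eq (f := fun x : EuclideanSpace ℝ (Fin n) => ‖x‖ ^ 2)
    (contDiff_norm_sq ℝ) (by simp_rw [funext laplacian_norm_sq]; exact integrable_const _)
    integrable_norm_sq_gauss (memLp_norm_sq_gauss.integrable_mul memLp_norm_sq_gauss)
  simp_rw [laplacian_norm_sq, integral_norm_sq_gauss] at h
  rw [integral_const, probReal_univ, one_smul] at h
  linarith

lemma gradient_sub_norm_sq {f : EuclideanSpace ℝ (Fin n) → ℝ} (hf : Differentiable ℝ f) (a : ℝ)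
    (x : EuclideanSpace ℝ (Fin n)) :
    gradient (fun y => f y - a * ‖y‖ ^ 2) x = gradient f x - (2 * a) • x := by
  have h : HasFDerivAt (fun y => f y - a * ‖y‖ ^ 2) (fderiv ℝ f x - a • (2 • innerSL ℝ x)) x :=
    (hf x).hasFDerivAt.sub ((hasStrictFDerivAt_norm_sq x).hasFDerivAt.const_mul a)
  refine ext_inner_right ℝ fun v => ?_
  rw [inner_gradient, h.fderiv, inner_sub_left, inner_gradient, inner_smul_left]
  simp
  ring

lemma continuous_gradient {f : EuclideanSpace ℝ (Fin n) → ℝ} (hf : ContDiff ℝ 1 f) :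
    Continuous (gradient f) :=
  (InnerProductSpace.toDual ℝ (EuclideanSpace ℝ (Fin n))).symm.continuous.comp
    (hf.continuous_fderiv one_ne_zero)

theorem refinedPoincare (hn : 1 ≤ n) : RefinedPoincare n := by
  intro f hf hL
  have hn0 : (0 : ℝ) < n := by exact_mod_cast hn
  have hf1 : ContDiff ℝ 1 f := hf.of_le (by norm_num)
  -- The subtracted term is a real number, so an infinite energy makes the right-hand side ⊤. A
  -- finite energy puts f in L², which gives meaning to all the moments below.
  by_cases hD : ∫⁻ x, ‖gradient f x‖ₑ ^ 2 ∂gauss n = ∞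
  · rw [hD, EReal.coe_ennreal_top, EReal.top_sub_coe]
    exact le_top
  have hconv : ∀ g : EuclideanSpace ℝ (Fin n) → ℝ, ∀ x, ‖gradient g x‖ₑ ^ 2 =
      ENNReal.ofReal (‖gradient g x‖ ^ 2) := fun g x => by
    rw [ENNReal.ofReal_pow (norm_nonneg _), ofReal_norm]
  obtain ⟨hfL2, -⟩ := memLp_and_evariance_le_gauss hf1 hD
  have hgc := continuous_gradient hf1
  have hG : Integrable (fun x => ‖gradient f x‖ ^ 2) (gauss n) := by
    refine ⟨(hgc.norm.pow 2).aestronglyMeasurable, ?_⟩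
    rw [hasFiniteIntegral_iff_ofReal (.of_forall fun x => sq_nonneg _)]
    simp_rw [← hconv]
    exact lt_top_iff_ne_top.2 hD
  have hQ := memLp_norm_sq_gauss (n := n)
  have hfi := hfL2.integrable one_le_two
  have hfx : Integrable (fun x => f x * ‖x‖ ^ 2) (gauss n) := hfL2.integrable_mul hQ
  have hin : Integrable (fun x => inner ℝ (gradient f x) x) (gauss n) := by
    refine (hG.add integrable_norm_sq_gauss).mono'
      (hgc.inner continuous_id).aestronglyMeasurable (.of_forall fun x => ?_)
    refine (norm_inner_le_norm _ _).trans ?_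
    simp only [Pi.add_apply]
    nlinarith [sq_nonneg (‖x‖ - ‖gradient f x‖), sq_nonneg ‖x‖, sq_nonneg ‖gradient f x‖]
  have l1 := integral_laplacian_eq hf hL hfi hfx
  have l2 := integral_laplacian_eq_integral_fderiv hf hL (by simpa only [inner_gradient] using hin)
  simp_rw [← inner_gradient] at l2
  set L := ∫ x, Laplacian.laplacian f x ∂gauss n with hLdef
  -- The energy minus the variance of f - a|x|² is quadratic in a, and this value minimises it,
  -- which gives the strongest conclusion.
  set a := L / (2 * n) with ha
  have hLa : L = 2 * n * a := by rw [ha]; field_simp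
  have hg1 : ContDiff ℝ 1 fun x => f x - a * ‖x‖ ^ 2 :=
    hf1.sub (contDiff_const.mul (contDiff_norm_sq ℝ))
  have hexp : ∀ x, ‖gradient (fun y => f y - a * ‖y‖ ^ 2) x‖ ^ 2 =
      ‖gradient f x‖ ^ 2 - 4 * a * inner ℝ (gradient f x) x + 4 * a ^ 2 * ‖x‖ ^ 2 := fun x => by
    rw [gradient_sub_norm_sq (hf1.differentiable one_ne_zero), norm_sub_sq_real, inner_smul_right,
      norm_smul, Real.norm_eq_abs, mul_pow, sq_abs]
    ring
  have j1 : Integrable (fun x => ‖gradient f x‖ ^ 2 - 4 * a * inner ℝ (gradient f x) x)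
    (gauss n) := hG.sub (hin.const_mul _)
  have j2 : Integrable (fun x => ‖gradient (fun y => f y - a * ‖y‖ ^ 2) x‖ ^ 2) (gauss n) := by
    simp_rw [hexp]
    exact j1.add (integrable_norm_sq_gauss.const_mul _)
  have hDg : ∫ x, ‖gradient (fun y => f y - a * ‖y‖ ^ 2) x‖ ^ 2 ∂gauss n =
      (∫ x, ‖gradient f x‖ ^ 2 ∂gauss n) - 4 * n * a ^ 2 := by
    simp_rw [hexp]
    rw [integral_add j1 (integrable_norm_sq_gauss.const_mul _),
      integral_sub hG (hin.const_mul _), integral_const_mul, integral_const_mul,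
      integral_norm_sq_gauss, ← l2, hLa]
    ring
  have hDg' : ∫⁻ x, ‖gradient (fun y => f y - a * ‖y‖ ^ 2) x‖ₑ ^ 2 ∂gauss n =
      ENNReal.ofReal (∫ x, ‖gradient (fun y => f y - a * ‖y‖ ^ 2) x‖ ^ 2 ∂gauss n) := by
    simp_rw [hconv]
    rw [ofReal_integral_eq_lintegral_ofReal j2 (.of_forall fun x => sq_nonneg _)]
  obtain ⟨hgL2, hgv⟩ := memLp_and_evariance_le_gauss hg1 (by rw [hDg']; exact ENNReal.ofReal_ne_top)
  rw [hDg', ← hgL2.ofReal_variance_eq,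
    ENNReal.ofReal_le_ofReal_iff (integral_nonneg fun x => sq_nonneg _), hDg] at hgv
  have hvg : variance (fun x => f x - a * ‖x‖ ^ 2) (gauss n) =
      variance f (gauss n) - 2 * n * a ^ 2 := by
    rw [variance_eq_sub hgL2, variance_eq_sub hfL2]
    simp only [Pi.pow_apply]
    have e : ∀ x, (f x - a * ‖x‖ ^ 2) ^ 2 =
        f x ^ 2 - 2 * a * (f x * ‖x‖ ^ 2) + a ^ 2 * (‖x‖ ^ 2 * ‖x‖ ^ 2) := fun x => by ring
    have k1 : Integrable (fun x => f x ^ 2 - 2 * a * (f x * ‖x‖ ^ 2)) (gauss n) :=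
      hfL2.integrable_sq.sub (hfx.const_mul _)
    have k2 : Integrable (fun x : EuclideanSpace ℝ (Fin n) => ‖x‖ ^ 2 * ‖x‖ ^ 2) (gauss n) :=
      hQ.integrable_mul hQ
    simp_rw [e]
    rw [integral_add k1 (k2.const_mul _), integral_sub hfL2.integrable_sq (hfx.const_mul _),
      integral_const_mul, integral_const_mul, integral_norm_pow_four_gauss,
      integral_sub hfi (integrable_norm_sq_gauss.const_mul a), integral_const_mul,
      integral_norm_sq_gauss]
    -- The covariance of f and |x|² is 2na; together with the variance 2n of |x|², the variance
    -- changes by -4na² + 2na².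
    have : ∫ x, f x * ‖x‖ ^ 2 ∂gauss n = 2 * n * a + n * ∫ x, f x ∂gauss n := by linarith
    rw [this]
    ring
  rw [hvg] at hgv
  have hDf : ∫⁻ x, ‖gradient f x‖ₑ ^ 2 ∂gauss n =
      ENNReal.ofReal (∫ x, ‖gradient f x‖ ^ 2 ∂gauss n) := by
    simp_rw [hconv]
    rw [ofReal_integral_eq_lintegral_ofReal hG (.of_forall fun x => sq_nonneg _)]
  rw [hDf, ← hfL2.ofReal_variance_eq, EReal.coe_ennreal_ofReal, EReal.coe_ennreal_ofReal,
    max_eq_left (variance_nonneg _ _), max_eq_left (integral_nonneg fun x => sq_nonneg _),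
    ← EReal.coe_sub, EReal.coe_le_coe_iff]
  have : 1 / (2 * n) * L ^ 2 = 2 * n * a ^ 2 := by rw [hLa]; field_simp
  rw [this]
  linarith

end GaussTransport

end

theorem mainTheorem6 (n : ℕ) (hn : 1 ≤ n) :
    GaussTransport.RefinedTalagrand n ∧
      (GaussTransport.RefinedTalagrand n → GaussTransport.ClassicalTalagrand n) ∧
      (GaussTransport.RefinedTalagrand n → GaussTransport.RefinedPoincare n) :=
  ⟨GaussTransport.refinedTalagrand hn, fun _ => GaussTransport.classicalTalagrand,
    fun _ => GaussTransport.refinedPoincare hn⟩
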